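/- **Theorem.** A $c$-colour graph ($c\ge 1$) is $G=(V,\{E_1,\dots,E_c\})$ with $|V|=n$, where each $E_i$ is the edge set of a simple undirected graph on $V$ (the edges of colour $i$; two nodes may be joined by edges of several colours); put $m=\sum_{i=1}^c|E_i|$. A uni-colour path is a path all of whose edges have the same colour; its length is its number of edges. In the $4$-LCDP problem one is given a $c$-colour graph $G$ and two distinct nodes $s,t\in V$, and seeks a maximum number of distinct uni-colour paths from $s$ to $t$, each of length at most $4$, that are mutually internally disjoint (no two of them have a common internal node; paths that consist of the single edge $st$ in different colours count as different). There exists a $2$-approximation algorithm for $4$-LCDP that runs in $O(p^2(c^2n+cm))$ time, where $p$ is the number of paths that it outputs. That is, there are a single program of a unit-cost random-access machine (with operations $+,\times$, truncated subtraction and comparison on words of $O(\log (n+c+m))$ bits) and a constant $K$ such that, for all $n$, all $c\ge 1$, every $c$-colour graph $G$ on the nodes $0,\dots,n-1$, and all nodes $s\neq t$ of $G$: given $n,c,m,s,t$ and a list, in any order, of the $m$ coloured edges of $G$, each listed once, the program halts, outputs (with all their nodes and colours) a number $p$ of distinct, mutually internally disjoint uni-colour $s$–$t$ paths of length at most $4$,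 where $2p$ is at least the number of paths in any such family, and does so within $K\max(p,1)^2(c^2n+cm)$ steps. -/

import Mathlib

/-! ### Random-access machines with a step count

A program uses finitely many registers and finitely many arrays (indexed by natural numbers) of
machine words; it is built from assignments, array writes, branching and loops. Each evaluation of
a constant, register, array cell or arithmetic operation costs one step, and so does each
assignment, array write and branching test. All words, including intermediate values and array
addresses, have to stay below a bound `W`: a program that would produce a larger value has no
execution. -/

namespace RAM

inductive BinOp where
  | add
  | sub
  | mul
  | lt
  | eq

/-- Subtraction is truncated at `0`; comparisons return `1` for true and `0` for false. -/
def BinOp.eval : BinOp → ℕ → ℕ → ℕ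
  | .add, x, y => x + y
  | .sub, x, y => x - y
  | .mul, x, y => x * y
  | .lt, x, y => if x < y then 1 else 0
  | .eq, x, y => if x = y then 1 else 0

inductive Expr where
  | const (k : ℕ)
  | reg (r : ℕ)
  | read (a : ℕ) (e : Expr)
  | op (o : BinOp) (e f : Expr)

inductive Cmd where
  | skip
  | assign (r : ℕ) (e : Expr)
  | write (a : ℕ) (e f : Expr)
  | seq (p q : Cmd)
  | ite (e : Expr) (p q : Cmd)
  | loop (e : Expr) (p : Cmd)

/-- `reg r` is the content of register `r`, and `arr a x` the content of cell `x` of array `a`. -/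
@[ext]
structure State where
  reg : ℕ → ℕ
  arr : ℕ → ℕ → ℕ

def State.setReg (σ : State) (r x : ℕ) : State :=
  { σ with reg := Function.update σ.reg r x }

def State.setArr (σ : State) (a i x : ℕ) : State :=
  { σ with arr := Function.update σ.arr a (Function.update (σ.arr a) i x) }

namespace Expr

def eval (σ : State) : Expr → ℕ
  | const k => k
  | reg r => σ.reg r
  | read a e => σ.arr a (e.eval σ)
  | op o e f => o.eval (e.eval σ) (f.eval σ)

/-- The number of elementary steps needed to evaluate an expression. -/
def cost : Expr → ℕ
  | const _ => 1
  | reg _ => 1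
  | read _ e => e.cost + 1
  | op _ e f => e.cost + f.cost + 1

/-- Every value that occurs in the evaluation of the expression is smaller than `W`. -/
def Fits (W : ℕ) (σ : State) : Expr → Prop
  | const k => k < W
  | reg r => σ.reg r < W
  | read a e => e.Fits W σ ∧ σ.arr a (e.eval σ) < W
  | op o e f => e.Fits W σ ∧ f.Fits W σ ∧ o.eval (e.eval σ) (f.eval σ) < W

end Expr

/-- `Exec W p σ k τ`: started in state `σ`, on a machine whose words are the numbers below `W`, the
program `p` halts in state `τ` after exactly `k` steps. -/
inductive Exec (W : ℕ) : Cmd → State → ℕ → State → Prop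
  | skip (σ : State) : Exec W .skip σ 1 σ
  | assign (σ : State) (r : ℕ) (e : Expr) (he : e.Fits W σ) :
      Exec W (.assign r e) σ (e.cost + 1) (σ.setReg r (e.eval σ))
  | write (σ : State) (a : ℕ) (e f : Expr) (he : e.Fits W σ) (hf : f.Fits W σ) :
      Exec W (.write a e f) σ (e.cost + f.cost + 1) (σ.setArr a (e.eval σ) (f.eval σ))
  | seq {p q : Cmd} {σ τ υ : State} {k l : ℕ} (hp : Exec W p σ k τ) (hq : Exec W q τ l υ) :
      Exec W (.seq p q) σ (k + l) υ
  | ite_true {e : Expr} {p q : Cmd} {σ τ : State} {k : ℕ} (he : e.Fits W σ) (h : e.eval σ ≠ 0)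
      (hp : Exec W p σ k τ) : Exec W (.ite e p q) σ (e.cost + 1 + k) τ
  | ite_false {e : Expr} {p q : Cmd} {σ τ : State} {k : ℕ} (he : e.Fits W σ) (h : e.eval σ = 0)
      (hq : Exec W q σ k τ) : Exec W (.ite e p q) σ (e.cost + 1 + k) τ
  | loop_true {e : Expr} {p : Cmd} {σ τ υ : State} {k l : ℕ} (he : e.Fits W σ)
      (h : e.eval σ ≠ 0) (hp : Exec W p σ k τ) (hl : Exec W (.loop e p) τ l υ) :
      Exec W (.loop e p) σ (e.cost + 1 + k + l) υ
  | loop_false {e : Expr} {p : Cmd} {σ : State} (he : e.Fits W σ) (h : e.eval σ = 0) :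
      Exec W (.loop e p) σ (e.cost + 1) σ

end RAM

/-! ### Colour graphs and disjoint uni-colour paths

A `c`-colour graph on the nodes `0, …, n - 1` is a family `G : Fin c → SimpleGraph (Fin n)`, where
`G i` consists of the edges of colour `i`; two nodes may be joined by edges of several colours. -/

namespace ColorGraph

/-- The number of coloured edges, i.e. the sum of the sizes of the edge sets. -/
noncomputable def numEdges {V : Type*} {c : ℕ} (G : Fin c → SimpleGraph V) : ℕ :=
  ∑ i, (G i).edgeSet.ncard

structure UniColorPath {V C : Type*} (G : C → SimpleGraph V) (s t : V) where
  color : C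
  walk : (G color).Walk s t
  isPath : walk.IsPath

/-- The set of internal nodes of a path. -/
def UniColorPath.interior {V C : Type*} {G : C → SimpleGraph V} {s t : V}
    (P : UniColorPath G s t) : Set V :=
  {v | v ∈ P.walk.support ∧ v ≠ s ∧ v ≠ t}

/-- `P` is a feasible solution with `p` paths of the length-bounded problem `l`-LCDP: it consists
of `p` distinct uni-colour paths from `s` to `t`, each with at most `l` edges, that are mutually
internally disjoint. -/
structure IsDisjointFamily {V C : Type*} {G : C → SimpleGraph V} {s t : V} (l : ℕ) {p : ℕ}
    (P : Fin p → UniColorPath G s t) : Prop where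
  injective : Function.Injective P
  length_le : ∀ k, (P k).walk.length ≤ l
  disjoint : Pairwise fun k k' => Disjoint (P k).interior (P k').interior

/-- A list, in arbitrary order and with arbitrary orientations, of all the coloured edges of `G`,
in which each of them occurs exactly once. -/
structure EdgeListing {n c : ℕ} (G : Fin c → SimpleGraph (Fin n)) (m : ℕ) where
  src : Fin m → Fin n
  dst : Fin m → Fin n
  color : Fin m → Fin c
  adj : ∀ k, (G (color k)).Adj (src k) (dst k)
  existsUnique : ∀ (i : Fin c) (u v : Fin n), (G i).Adj u v →
    ∃! k, color k = i ∧ s(src k, dst k) = s(u, v)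

theorem EdgeListing.numEdges_eq {n c m : ℕ} {G : Fin c → SimpleGraph (Fin n)}
    (L : EdgeListing G m) : numEdges G = m := by
  classical
  have h : Nat.card (Σ i, (G i).edgeSet) = m := by
    rw [← Nat.card_fin m]
    symm
    refine Nat.card_congr (Equiv.ofBijective
      (fun k => ⟨L.color k, ⟨s(L.src k, L.dst k), L.adj k⟩⟩) ⟨?_, ?_⟩)
    · intro k k' hk
      obtain ⟨_, _, hu⟩ := L.existsUnique _ _ _ (L.adj k')
      have h1 : L.color k = L.color k' := congrArg Sigma.fst hk
      have h2 : s(L.src k, L.dst k) = s(L.src k', L.dst k') :=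
        congrArg (fun x : (Σ i, (G i).edgeSet) => (x.2 : Sym2 (Fin n))) hk
      rw [hu k ⟨h1, h2⟩, hu k' ⟨rfl, rfl⟩]
    · rintro ⟨i, ⟨e, he⟩⟩
      induction e using Sym2.ind with
      | _ u v =>
        obtain ⟨k, ⟨rfl, hk⟩, _⟩ := L.existsUnique i u v he
        exact ⟨k, by simp only [hk]⟩
  rw [← h, Nat.card_sigma]
  rfl

/-- The memory at the beginning of a computation on the instance `(G, s, t)`: the registers
`0, …, 4` contain `n`, `c`, `m`, `s`, `t`, the cells `0, …, m - 1` of the arrays `0`, `1`, `2`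
contain the two endpoints and the colours of the edges, and everything else is `0`. -/
def EdgeListing.inputState {n c m : ℕ} {G : Fin c → SimpleGraph (Fin n)}
    (L : EdgeListing G m) (s t : Fin n) : RAM.State where
  reg r :=
    match r with
    | 0 => n
    | 1 => c
    | 2 => m
    | 3 => s
    | 4 => t
    | _ => 0
  arr a x :=
    if h : x < m then
      match a with
      | 0 => L.src ⟨x, h⟩
      | 1 => L.dst ⟨x, h⟩
      | 2 => L.color ⟨x, h⟩
      | _ => 0
    else 0

/-- The memory `σ` at the end of a computation contains the family `P` of `p` paths: register `5`
contains `p`, and for each `k < p` the cells `k` of the arrays `3`, `4` and `5 + j` contain the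
colour, the length and the `j`-th node of the path `P k`. -/
structure IsOutput {n c : ℕ} {G : Fin c → SimpleGraph (Fin n)} {s t : Fin n} (σ : RAM.State)
    {p : ℕ} (P : Fin p → UniColorPath G s t) : Prop where
  number : σ.reg 5 = p
  color : ∀ k : Fin p, σ.arr 3 k = (P k).color
  length : ∀ k : Fin p, σ.arr 4 k = (P k).walk.length
  node : ∀ k : Fin p, ∀ j ≤ (P k).walk.length, σ.arr (5 + j) k = (P k).walk.getVert j

end ColorGraph

/-! Paths consisting of the edge st alone have no internal nodes, so they conflict with nothing:
there is exactly one for each colour in which s and t are adjacent, and all of them are output. A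
path of length 2, 3 or 4 matters only through its internal nodes, a nonempty set of at most three
elements, so the rest of the problem is a packing of 3-sets, attacked by local search: as long as
some path of the family can be replaced by two, do so. A locally optimal packing F is at least half
as large as any other packing Q (`card_le_two_mul_card_of_locally_optimal`). Every member of Q meets
F, and two members of Q cannot both meet only the same member of F, as they could replace it; so at
most |F| members of Q meet exactly one member of F. Each member of F meets at most three members of
Q. Hence 2|Q| ≤ 3|F| + |F|. An improvement is sought without enumerating paths. One path of length
at most 4 that avoids a given node set is found colour by colour with four rounds of edge
relaxation, in O(c(n+m)) steps (`run_searchCmd`). To find a disjoint pair A, B, maintain a set S of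
nodes that B must contain. Take a candidate A avoiding S; if there is none, no such pair exists. If
some B avoids the candidate, the pair is found; otherwise every B meets the candidate, and one
branches over its at most three internal nodes, adding the chosen one to S. Since B has at most
three internal nodes, depth three suffices, so a bounded number of path searches decides whether a
pair exists (`run_branchCmd`). With p paths in the family and r indices already tested in vain, each
attempt either increases r or increases p and resets r, so p² + r grows each time. There are
therefore O(p²) attempts (`exec_searchLoop`), which gives O(max(p,1)² c(n+m)) steps in all. The
program is verified by a small program logic that bounds running time and word size together. -/

/-! ### A program logic for random-access machines -/

namespace RAM

@[simp] theorem State.reg_setReg (σ : State) (r x r' : ℕ) :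
    (σ.setReg r x).reg r' = if r' = r then x else σ.reg r' := by
  simp [State.setReg, Function.update_apply]

@[simp] theorem State.arr_setReg (σ : State) (r x : ℕ) : (σ.setReg r x).arr = σ.arr := rfl

@[simp] theorem State.reg_setArr (σ : State) (a i x : ℕ) : (σ.setArr a i x).reg = σ.reg := rfl

@[simp] theorem State.arr_setArr (σ : State) (a i x a' : ℕ) :
    (σ.setArr a i x).arr a' = if a' = a then Function.update (σ.arr a) i x else σ.arr a' := by
  simp [State.setArr, Function.update_apply]

/-- All words in the memory are smaller than `W`. -/
structure State.Bdd (W : ℕ) (σ : State) : Prop where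
  reg : ∀ r, σ.reg r < W
  arr : ∀ a x, σ.arr a x < W

theorem Expr.Fits.eval_lt {W : ℕ} {σ : State} {e : Expr} (h : e.Fits W σ) : e.eval σ < W := by
  cases e with
  | const k => exact h
  | reg r => exact h
  | read a e => exact h.2
  | op o e f => exact h.2.2

theorem State.Bdd.setReg {W : ℕ} {σ : State} (h : σ.Bdd W) {r x : ℕ} (hx : x < W) :
    (σ.setReg r x).Bdd W := by
  refine ⟨fun r' => ?_, fun a y => h.arr a y⟩
  rw [State.reg_setReg]
  split_ifs
  · exact hx
  · exact h.reg r'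

theorem State.Bdd.setArr {W : ℕ} {σ : State} (h : σ.Bdd W) {a i x : ℕ} (hx : x < W) :
    (σ.setArr a i x).Bdd W := by
  refine ⟨h.reg, fun a' y => ?_⟩
  rw [State.arr_setArr]
  split_ifs
  · rw [Function.update_apply]
    split_ifs
    · exact hx
    · exact h.arr a y
  · exact h.arr a' y

/-- Only values of expressions that fit are ever stored. Boundedness of the memory is thus an
invariant, and what remains to be checked is that constants, sums and products stay small. -/
theorem Exec.bdd {W : ℕ} {p : Cmd} {σ τ : State} {k : ℕ} (h : Exec W p σ k τ) :
    σ.Bdd W → τ.Bdd W := by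
  induction h with
  | skip => exact id
  | assign σ r e he => exact fun hb => hb.setReg he.eval_lt
  | write σ a e f he hf => exact fun hb => hb.setArr hf.eval_lt
  | seq _ _ ih1 ih2 => exact fun hb => ih2 (ih1 hb)
  | ite_true _ _ _ ih => exact ih
  | ite_false _ _ _ ih => exact ih
  | loop_true _ _ _ _ ih1 ih2 => exact fun hb => ih2 (ih1 hb)
  | loop_false => exact id

/-- What has to be checked, in a bounded memory, for the evaluation of an expression to stay below
`W`. -/
def Expr.Ok (W : ℕ) (σ : State) : Expr → Prop
  | const k => k < W
  | reg _ => True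
  | read _ e => e.Ok W σ
  | op .add e f => e.Ok W σ ∧ f.Ok W σ ∧ e.eval σ + f.eval σ < W
  | op .mul e f => e.Ok W σ ∧ f.Ok W σ ∧ e.eval σ * f.eval σ < W
  | op _ e f => e.Ok W σ ∧ f.Ok W σ

theorem Expr.Ok.fits {W : ℕ} (hW : 1 < W) {σ : State} (hb : σ.Bdd W) :
    ∀ {e : Expr}, e.Ok W σ → e.Fits W σ
  | .const _, h => h
  | .reg r, _ => hb.reg r
  | .read a e, h => ⟨Ok.fits hW hb (e := e) h, hb.arr a _⟩
  | .op o e f, h => by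
    cases o with
    | add => exact ⟨Ok.fits hW hb h.1, Ok.fits hW hb h.2.1, h.2.2⟩
    | mul => exact ⟨Ok.fits hW hb h.1, Ok.fits hW hb h.2.1, h.2.2⟩
    | sub =>
      exact ⟨Ok.fits hW hb h.1, Ok.fits hW hb h.2,
        (Nat.sub_le _ _).trans_lt (Ok.fits hW hb h.1).eval_lt⟩
    | lt =>
      refine ⟨Ok.fits hW hb h.1, Ok.fits hW hb h.2, ?_⟩
      simp only [BinOp.eval]
      split_ifs <;> omega
    | eq =>
      refine ⟨Ok.fits hW hb h.1, Ok.fits hW hb h.2, ?_⟩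
      simp only [BinOp.eval]
      split_ifs <;> omega

namespace Cmd

/-- The program does not assign to register `r`. -/
def KeepsReg (r : ℕ) : Cmd → Prop
  | skip => True
  | assign r' _ => r ≠ r'
  | write _ _ _ => True
  | seq p q => p.KeepsReg r ∧ q.KeepsReg r
  | ite _ p q => p.KeepsReg r ∧ q.KeepsReg r
  | loop _ p => p.KeepsReg r

/-- The program does not write to array `a`. -/
def KeepsArr (a : ℕ) : Cmd → Prop
  | skip => True
  | assign _ _ => True
  | write a' _ _ => a ≠ a'
  | seq p q => p.KeepsArr a ∧ q.KeepsArr a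
  | ite _ p q => p.KeepsArr a ∧ q.KeepsArr a
  | loop _ p => p.KeepsArr a

end Cmd

theorem Exec.reg_eq {W r : ℕ} {p : Cmd} {σ τ : State} {k : ℕ} (h : Exec W p σ k τ) :
    p.KeepsReg r → τ.reg r = σ.reg r := by
  induction h with
  | skip => exact fun _ => rfl
  | assign σ r' e he => exact fun hr => by simp [show r ≠ r' from hr]
  | write σ a e f he hf => exact fun _ => rfl
  | seq _ _ ih1 ih2 => exact fun hr => (ih2 hr.2).trans (ih1 hr.1)
  | ite_true _ _ _ ih => exact fun hr => ih hr.1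
  | ite_false _ _ _ ih => exact fun hr => ih hr.2
  | loop_true _ _ _ _ ih1 ih2 => exact fun hr => (ih2 hr).trans (ih1 hr)
  | loop_false => exact fun _ => rfl

theorem Exec.arr_eq {W a : ℕ} {p : Cmd} {σ τ : State} {k : ℕ} (h : Exec W p σ k τ) :
    p.KeepsArr a → τ.arr a = σ.arr a := by
  induction h with
  | skip => exact fun _ => rfl
  | assign σ r' e he => exact fun _ => rfl
  | write σ a' e f he hf => exact fun hr => by simp [show a ≠ a' from hr]
  | seq _ _ ih1 ih2 => exact fun hr => (ih2 hr.2).trans (ih1 hr.1)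
  | ite_true _ _ _ ih => exact fun hr => ih hr.1
  | ite_false _ _ _ ih => exact fun hr => ih hr.2
  | loop_true _ _ _ _ ih1 ih2 => exact fun hr => (ih2 hr).trans (ih1 hr)
  | loop_false => exact fun _ => rfl

/-- Started in `σ`, the program halts in a state satisfying `Q` after at most `T` steps. -/
def Run (W T : ℕ) (p : Cmd) (σ : State) (Q : State → Prop) : Prop :=
  σ.Bdd W → ∃ k τ, Exec W p σ k τ ∧ k ≤ T ∧ Q τ

/-! ### Rules for total correctness with a time bound -/

section rules

variable {W T T' : ℕ} {p q : Cmd} {e : Expr} {σ : State} {Q Q' : State → Prop}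

theorem Run.mono (h : Run W T p σ Q) (hT : T ≤ T') (hQ : ∀ τ, τ.Bdd W → Q τ → Q' τ) :
    Run W T' p σ Q' := fun hb => by
  obtain ⟨k, τ, he, hk, hq⟩ := h hb
  exact ⟨k, τ, he, hk.trans hT, hQ τ (he.bdd hb) hq⟩

theorem Run.le (h : Run W T p σ Q) (hT : T ≤ T') : Run W T' p σ Q :=
  h.mono hT fun _ _ h => h

/-- Specifications only have to say what changes; everything else follows from the syntactic
conditions `KeepsReg` and `KeepsArr`. -/
theorem Run.frame (h : Run W T p σ Q) :
    Run W T p σ fun τ => Q τ ∧ (∀ r, p.KeepsReg r → τ.reg r = σ.reg r) ∧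
      ∀ a, p.KeepsArr a → τ.arr a = σ.arr a := fun hb => by
  obtain ⟨k, τ, he, hk, hq⟩ := h hb
  exact ⟨k, τ, he, hk, hq, fun _ hr => he.reg_eq hr, fun _ ha => he.arr_eq ha⟩

theorem Run.seq (h : Run W T p σ fun τ => Run W T' q τ Q) : Run W (T + T') (p.seq q) σ Q :=
  fun hb => by
  obtain ⟨k, τ, he, hk, hq⟩ := h hb
  obtain ⟨l, υ, he', hl, hq'⟩ := hq (he.bdd hb)
  exact ⟨k + l, υ, .seq he he', by omega, hq'⟩

theorem Run.ite (hW : 1 < W) (h : e.Ok W σ) (hp : e.eval σ ≠ 0 → Run W T p σ Q)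
    (hq : e.eval σ = 0 → Run W T q σ Q) : Run W (e.cost + 1 + T) (.ite e p q) σ Q := fun hb => by
  by_cases h0 : e.eval σ = 0
  · obtain ⟨k, τ, he, hk, hq⟩ := hq h0 hb
    exact ⟨_, τ, .ite_false (h.fits hW hb) h0 he, by omega, hq⟩
  · obtain ⟨k, τ, he, hk, hq⟩ := hp h0 hb
    exact ⟨_, τ, .ite_true (h.fits hW hb) h0 he, by omega, hq⟩

/-- The weakest precondition of a program without loops. -/
def Cmd.wp (W : ℕ) : Cmd → State → (State → Prop) → Prop
  | .skip, σ, Q => Q σ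
  | .assign r e, σ, Q => e.Ok W σ ∧ Q (σ.setReg r (e.eval σ))
  | .write a e f, σ, Q => e.Ok W σ ∧ f.Ok W σ ∧ Q (σ.setArr a (e.eval σ) (f.eval σ))
  | .seq p q, σ, Q => p.wp W σ fun τ => q.wp W τ Q
  | .ite e p q, σ, Q => e.Ok W σ ∧ (e.eval σ ≠ 0 → p.wp W σ Q) ∧ (e.eval σ = 0 → q.wp W σ Q)
  | .loop _ _, _, _ => False

theorem Cmd.wp_mono {p : Cmd} {σ : State} (h : ∀ τ, Q τ → Q' τ) (hp : p.wp W σ Q) :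
    p.wp W σ Q' := by
  induction p generalizing σ Q Q' with
  | skip => exact h _ hp
  | assign r e => exact ⟨hp.1, h _ hp.2⟩
  | write a e f => exact ⟨hp.1, hp.2.1, h _ hp.2.2⟩
  | seq p q ihp ihq => exact ihp (fun τ hτ => ihq h hτ) hp
  | ite e p q ihp ihq =>
    exact ⟨hp.1, fun h0 => ihp h (hp.2.1 h0), fun h0 => ihq h (hp.2.2 h0)⟩
  | loop e p => exact hp

/-- A bound on the running time of a program without loops. -/
def Cmd.time : Cmd → ℕ
  | .skip => 1
  | .assign _ e => e.cost + 1
  | .write _ e f => e.cost + f.cost + 1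
  | .seq p q => p.time + q.time
  | .ite e p q => e.cost + 1 + (p.time + q.time)
  | .loop _ _ => 0

theorem Run.flat (hW : 1 < W) (h : p.wp W σ Q) : Run W p.time p σ Q := by
  induction p generalizing σ Q with
  | skip => exact fun _ => ⟨_, _, .skip σ, le_rfl, h⟩
  | assign r e => exact fun hb => ⟨_, _, .assign σ r e (h.1.fits hW hb), le_rfl, h.2⟩
  | write a e f =>
    exact fun hb => ⟨_, _, .write σ a e f (h.1.fits hW hb) (h.2.1.fits hW hb), le_rfl, h.2.2⟩
  | seq p q ihp ihq =>
    exact Run.seq ((ihp h).mono le_rfl fun τ _ hτ => ihq hτ)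
  | ite e p q ihp ihq =>
    exact Run.ite hW h.1 (fun h0 => (ihp (h.2.1 h0)).le (by omega))
      (fun h0 => (ihq (h.2.2 h0)).le (by omega))
  | loop e p => exact h.elim

/-- `for i = 0, …, reg N - 1 do p` -/
def Cmd.forTo (i N : ℕ) (p : Cmd) : Cmd :=
  .seq (.assign i (.const 0)) (.loop (.op .lt (.reg i) (.reg N))
    (.seq p (.assign i (.op .add (.reg i) (.const 1)))))

@[simp] theorem Cmd.keepsReg_forTo {i N r : ℕ} :
    (Cmd.forTo i N p).KeepsReg r ↔ r ≠ i ∧ p.KeepsReg r := by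
  simp only [Cmd.forTo, Cmd.KeepsReg]
  tauto

@[simp] theorem Cmd.keepsArr_forTo {i N a : ℕ} :
    (Cmd.forTo i N p).KeepsArr a ↔ p.KeepsArr a := by
  simp [Cmd.forTo, Cmd.KeepsArr]

/-- Each round pays 4 steps for the test and 4 for the increment, which gives the 8; initialisation
and the last test give the 6. The counter never exceeds the content of register `N`, so it cannot
overflow. The invariant after a round is stated with the counter already advanced, since the
increment lies outside `p`. -/
theorem Run.forTo {i N : ℕ} (I : ℕ → State → Prop) (hW : 1 < W) (hne : N ≠ i)
    (hi : p.KeepsReg i) (hN : p.KeepsReg N) (h0 : I 0 (σ.setReg i 0))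
    (hstep : ∀ k τ, k < σ.reg N → τ.reg i = k →
      (∀ r, r ≠ i → p.KeepsReg r → τ.reg r = σ.reg r) →
      (∀ a, p.KeepsArr a → τ.arr a = σ.arr a) → I k τ →
      Run W T p τ fun υ => I (k + 1) (υ.setReg i (k + 1))) :
    Run W (σ.reg N * (T + 8) + 6) (.forTo i N p) σ (I (σ.reg N)) := by
  have key : ∀ d k τ, k + d = σ.reg N → τ.reg i = k →
      (∀ r, r ≠ i → p.KeepsReg r → τ.reg r = σ.reg r) →
      (∀ a, p.KeepsArr a → τ.arr a = σ.arr a) → I k τ →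
      Run W (d * (T + 8) + 4) (.loop (.op .lt (.reg i) (.reg N))
        (.seq p (.assign i (.op .add (.reg i) (.const 1))))) τ (I (σ.reg N)) := by
    intro d
    induction d with
    | zero =>
      intro k τ hk hik hr _ hI hb
      have : k = σ.reg N := by omega
      subst this
      refine ⟨_, τ, .loop_false (Expr.Ok.fits hW hb ⟨trivial, trivial⟩) ?_, ?_, hI⟩
      · simp [Expr.eval, BinOp.eval, hik, hr N hne hN]
      · simp [Expr.cost]
    | succ d ih =>
      intro k τ hk hik hr ha hI hb
      obtain ⟨l, υ, he, hl, hI'⟩ := hstep k τ (by omega) hik hr ha hI hb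
      have hbυ := he.bdd hb
      have hυi : υ.reg i = k := (he.reg_eq hi).trans hik
      have hυN : υ.reg N = σ.reg N := (he.reg_eq hN).trans (hr N hne hN)
      have hlt := hbυ.reg N
      have hE : Exec W (.assign i (.op .add (.reg i) (.const 1))) υ 4 (υ.setReg i (k + 1)) := by
        have := Exec.assign (W := W) υ i (.op .add (.reg i) (.const 1))
          (Expr.Ok.fits hW hbυ ⟨trivial, hW, by simp only [Expr.eval, hυi]; omega⟩)
        simpa [Expr.eval, BinOp.eval, hυi, Expr.cost] using this
      obtain ⟨l', φ, he', hl', hφ⟩ := ih (k + 1) (υ.setReg i (k + 1)) (by omega) (by simp)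
        (fun r hri hrp => by simp [hri, he.reg_eq hrp, hr r hri hrp])
        (fun a hap => by simp [he.arr_eq hap, ha a hap]) hI' (hE.bdd hbυ)
      refine ⟨_, φ, .loop_true (Expr.Ok.fits hW hb ⟨trivial, trivial⟩) ?_ (.seq he hE) he',
        ?_, hφ⟩
      · have : k < σ.reg N := by omega
        simp [Expr.eval, BinOp.eval, hik, hr N hne hN, this]
      · simp only [Expr.cost]
        rw [Nat.add_mul]
        omega
  have := Run.seq (W := W) (T := 2) (p := .assign i (.const 0)) (σ := σ)
    (q := .loop (.op .lt (.reg i) (.reg N)) (.seq p (.assign i (.op .add (.reg i) (.const 1)))))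
    (T' := σ.reg N * (T + 8) + 4) (Q := I (σ.reg N))
    ((Run.flat hW (p := .assign i (.const 0)) (Q := fun τ => τ = σ.setReg i 0)
      ⟨by simp only [Expr.Ok]; omega, rfl⟩).mono le_rfl fun τ _ hτ => by
        subst hτ
        exact key _ 0 _ (by omega) (by simp) (fun r hri _ => by simp [hri]) (fun _ _ => rfl) h0)
  exact this.le (by omega)

/-- A loop with a termination measure `μ`; the running time is accounted for by the increase of the
potential `φ`. -/
theorem exec_loop (Inv : State → Prop) (μ φ : State → ℕ) (hW : 1 < W) (T : ℕ)
    (hok : ∀ τ, e.Ok W τ)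
    (hstep : ∀ τ, Inv τ → e.eval τ ≠ 0 → Run W T p τ fun υ => Inv υ ∧ μ υ < μ τ ∧
      e.cost + 1 + T + φ τ ≤ φ υ) (hb : σ.Bdd W) (hI : Inv σ) :
    ∃ k τ, Exec W (.loop e p) σ k τ ∧ Inv τ ∧ e.eval τ = 0 ∧ k + φ σ ≤ φ τ + (e.cost + 1) := by
  induction hμ : μ σ using Nat.strong_induction_on generalizing σ with
  | _ M ih =>
    by_cases h0 : e.eval σ = 0
    · exact ⟨_, σ, .loop_false ((hok σ).fits hW hb) h0, hI, h0, by omega⟩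
    · obtain ⟨k, τ, he, hk, hI', hlt, hφ⟩ := hstep σ hI h0 hb
      obtain ⟨l, υ, he', hI'', h0', hl⟩ := ih _ (hμ ▸ hlt) (he.bdd hb) hI' rfl
      exact ⟨_, υ, .loop_true ((hok σ).fits hW hb) h0 he he', hI'', h0', by omega⟩

end rules

end RAM

/-! ### Local search for packings of sets with at most three elements -/

section packing

variable {α ι κ : Type*} [DecidableEq α] [Fintype ι] [Fintype κ]

open Finset in
/-- A packing of sets of size at most three such that no member can be replaced by two sets has at
least half as many members as any other packing. -/
theorem card_le_two_mul_card_of_locally_optimal {𝒜 : Set (Finset α)} (h3 : ∀ A ∈ 𝒜, #A ≤ 3)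
    {F : ι → Finset α} {Q : κ → Finset α} (hF : ∀ k, F k ∈ 𝒜) (hQ : ∀ i, Q i ∈ 𝒜)
    (dF : Pairwise fun k k' => Disjoint (F k) (F k'))
    (dQ : Pairwise fun i i' => Disjoint (Q i) (Q i')) [Nonempty ι]
    (hopt : ∀ r, ∀ A ∈ 𝒜, ∀ B ∈ 𝒜, Disjoint A B → (∀ k ≠ r, Disjoint A (F k)) →
      ¬ ∀ k ≠ r, Disjoint B (F k)) :
    Fintype.card κ ≤ 2 * Fintype.card ι := by
  classical
  -- The members of `F` that are met by `Q i`.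
  let N : κ → Finset ι := fun i => univ.filter fun k => ¬ Disjoint (Q i) (F k)
  have hmem : ∀ i k, k ∈ N i ↔ ¬ Disjoint (Q i) (F k) := fun i k => by simp [N]
  have hne : ∀ i, ∃ k, k ∈ N i := by
    intro i
    by_contra! h
    obtain ⟨r⟩ := ‹Nonempty ι›
    have hd : ∀ k, Disjoint (Q i) (F k) := fun k => by simpa [hmem] using h k
    -- A set `Q i` that meets no member could be added; this is the swap of `F r` for `F r` and `Q
    -- i`, which is why some index `r` is needed.
    exact hopt r _ (hF r) _ (hQ i) (hd r).symm (fun k hk => dF hk.symm) fun k _ => hd k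
  choose f hf using hne
  -- Two sets of `Q` whose only conflict is with the same member of `F` would be an improving swap
  -- for it.
  have hS : #(univ.filter fun i => #(N i) = 1) ≤ Fintype.card ι := by
    refine card_le_card_of_injOn f (fun _ _ => mem_univ _) fun i hi i' hi' hii => ?_
    by_contra hne
    have hone : ∀ j, #(N j) = 1 → ∀ k ≠ f j, Disjoint (Q j) (F k) := by
      intro j hj k hk
      by_contra hd
      exact hk (card_le_one.1 hj.le _ ((hmem j k).2 hd) _ (hf j))
    simp only [coe_filter, mem_univ, true_and, Set.mem_ofPred_eq] at hi hi'
    exact hopt (f i) _ (hQ i) _ (hQ i') (dQ hne) (hone i hi) (hii ▸ hone i' hi')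
  -- Double counting of conflicts: the sets `Q i` that meet `F k` do so in different elements of `F
  -- k`, of which there are at most three.
  have hE : ∑ i, #(N i) ≤ 3 * Fintype.card ι := by
    have hdc := sum_card_bipartiteAbove_eq_sum_card_bipartiteBelow (s := (univ : Finset κ))
      (t := (univ : Finset ι)) fun i k => ¬ Disjoint (Q i) (F k)
    calc ∑ i, #(N i) = ∑ k, #(univ.filter fun i => ¬ Disjoint (Q i) (F k)) := hdc
      _ ≤ ∑ _k : ι, 3 := by
        refine sum_le_sum fun k _ => le_trans ?_ (h3 _ (hF k))
        have : ∀ i, ∃ x, ¬ Disjoint (Q i) (F k) → x ∈ Q i ∧ x ∈ F k := by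
          intro i
          by_cases h : Disjoint (Q i) (F k)
          · by_cases hα : Nonempty α
            · exact ⟨hα.some, fun h' => (h' h).elim⟩
            · rw [not_nonempty_iff] at hα
              have : Nonempty κ := ⟨i⟩
              obtain ⟨x, _⟩ := not_disjoint_iff.1 ((hmem i (f i)).1 (hf i))
              exact hα.elim x
          · obtain ⟨x, hx⟩ := not_disjoint_iff.1 h
            exact ⟨x, fun _ => hx⟩
        choose g hg using this
        refine card_le_card_of_injOn g (fun i hi => (hg i (by simpa using hi)).2) ?_
        intro i hi i' hi' hii
        by_contra hne
        have h1 := (hg i (by simpa using hi)).1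
        have h2 := (hg i' (by simpa using hi')).1
        rw [hii] at h1
        exact disjoint_left.1 (dQ hne) h1 h2
      _ = 3 * Fintype.card ι := by simp [mul_comm]
  -- Termwise: a set with one conflict is counted once in each summand, any other set has at least
  -- two conflicts.
  have hlow : 2 * Fintype.card κ ≤ ∑ i, #(N i) + #(univ.filter fun i => #(N i) = 1) := by
    rw [card_filter, ← sum_add_distrib]
    calc 2 * Fintype.card κ = ∑ _i : κ, 2 := by simp [mul_comm]
      _ ≤ _ := by
        refine sum_le_sum fun i _ => ?_
        have : 0 < #(N i) := card_pos.2 ⟨_, hf i⟩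
        split_ifs <;> omega
  omega

end packing

/-! ### Instances given by arc lists -/

/-- A colour graph on the nodes below `n` with two distinguished nodes, given by a list of coloured
edges. -/
structure ArcInstance where
  (n c m s t : ℕ)
  (src dst col : ℕ → ℕ)
  src_lt : ∀ k < m, src k < n
  dst_lt : ∀ k < m, dst k < n
  col_lt : ∀ k < m, col k < c
  ne : ∀ k < m, src k ≠ dst k
  inj : ∀ k < m, ∀ k' < m, col k = col k' → s(src k, dst k) = s(src k', dst k') → k = k'
  s_lt : s < n
  t_lt : t < n
  s_ne_t : s ≠ t
  c_pos : 1 ≤ c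

/-- The colour, the length and the internal nodes of a uni-colour path. -/
structure PathData where
  (len col x y z : ℕ)

namespace ArcInstance

variable (I : ArcInstance)

/-- The list entry `k` joins `a` to `b` in colour `i`. -/
def ArcAt (i k a b : ℕ) : Prop :=
  I.col k = i ∧ ((I.src k = a ∧ I.dst k = b) ∨ (I.dst k = a ∧ I.src k = b))

def Adj (i a b : ℕ) : Prop := ∃ k < I.m, I.ArcAt i k a b

variable {I} {i a b : ℕ}

theorem Adj.symm (h : I.Adj i a b) : I.Adj i b a := by
  obtain ⟨k, hk, hi, h⟩ := h
  exact ⟨k, hk, hi, by tauto⟩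

theorem Adj.ne (h : I.Adj i a b) : a ≠ b := by
  obtain ⟨k, hk, hi, ⟨rfl, rfl⟩ | ⟨rfl, rfl⟩⟩ := h
  exacts [I.ne k hk, (I.ne k hk).symm]

theorem Adj.lt_left (h : I.Adj i a b) : a < I.n := by
  obtain ⟨k, hk, hi, ⟨rfl, rfl⟩ | ⟨rfl, rfl⟩⟩ := h
  exacts [I.src_lt k hk, I.dst_lt k hk]

theorem Adj.lt_right (h : I.Adj i a b) : b < I.n := h.symm.lt_left

theorem Adj.col_lt (h : I.Adj i a b) : i < I.c := by
  obtain ⟨k, hk, rfl, -⟩ := h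
  exact I.col_lt k hk

theorem ArcAt.unique {k k' : ℕ} (h : I.ArcAt i k a b) (h' : I.ArcAt i k' a b) (hk : k < I.m)
    (hk' : k' < I.m) : k = k' :=
  I.inj k hk k' hk' (h.1.trans h'.1.symm) (by
    rw [Sym2.eq_iff]
    obtain ⟨-, h⟩ := h
    obtain ⟨-, h'⟩ := h'
    omega)

variable (I)

/-- The data describe a path from `s` to `t` of length two, three or four; unused internal nodes
are `t`. -/
def Valid (D : PathData) : Prop :=
  (D.len = 2 ∧ I.Adj D.col I.s D.x ∧ I.Adj D.col D.x I.t ∧ D.y = I.t ∧ D.z = I.t) ∨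
  (D.len = 3 ∧ I.Adj D.col I.s D.x ∧ I.Adj D.col D.x D.y ∧ I.Adj D.col D.y I.t ∧ D.z = I.t ∧
    D.x ≠ I.t ∧ D.y ≠ I.s) ∨
  (D.len = 4 ∧ I.Adj D.col I.s D.x ∧ I.Adj D.col D.x D.y ∧ I.Adj D.col D.y D.z ∧
    I.Adj D.col D.z I.t ∧ D.x ≠ I.t ∧ D.y ≠ I.s ∧ D.y ≠ I.t ∧ D.z ≠ I.s ∧ D.x ≠ D.z)

/-- Erasing `t` removes the padding, so the same formula serves all three lengths. -/
def interior (D : PathData) : Finset ℕ := ({D.x, D.y, D.z} : Finset ℕ).erase I.t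

variable {I} {D : PathData}

theorem mem_interior {v : ℕ} : v ∈ I.interior D ↔ v ≠ I.t ∧ (v = D.x ∨ v = D.y ∨ v = D.z) := by
  simp [interior]

theorem card_interior_le : (I.interior D).card ≤ 3 :=
  (Finset.card_erase_le).trans Finset.card_le_three

theorem Valid.col_lt (h : I.Valid D) : D.col < I.c := by
  obtain ⟨-, h, -⟩ | ⟨-, h, -⟩ | ⟨-, h, -⟩ := h <;> exact h.col_lt

theorem Valid.lt (h : I.Valid D) : D.x < I.n ∧ D.y < I.n ∧ D.z < I.n := by
  have := I.t_lt
  obtain ⟨-, h1, h2, h3, h4⟩ | ⟨-, h1, h2, h3, h4, -⟩ | ⟨-, h1, h2, h3, h4, -⟩ := h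
  · exact ⟨h1.lt_right, by omega, by omega⟩
  · exact ⟨h1.lt_right, h2.lt_right, by omega⟩
  · exact ⟨h1.lt_right, h2.lt_right, h3.lt_right⟩

theorem Valid.ne_s (h : I.Valid D) : D.x ≠ I.s ∧ D.y ≠ I.s ∧ D.z ≠ I.s := by
  have := I.s_ne_t
  obtain ⟨-, h1, h2, h3, h4⟩ | ⟨-, h1, h2, h3, h4, h5, h6⟩ |
    ⟨-, h1, h2, h3, h4, h5, h6, h7, h8, h9⟩ := h
  · exact ⟨h1.ne.symm, by omega, by omega⟩
  · exact ⟨h1.ne.symm, h6, by omega⟩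
  · exact ⟨h1.ne.symm, h6, h8⟩

theorem Valid.x_ne_t (h : I.Valid D) : D.x ≠ I.t := by
  obtain ⟨-, h1, h2, h3, h4⟩ | ⟨-, h1, h2, h3, h4, h5, h6⟩ | ⟨-, h1, h2, h3, h4, h5, h6⟩ := h
  exacts [h2.ne, h5, h5]

theorem Valid.len_mem (h : I.Valid D) : 2 ≤ D.len ∧ D.len ≤ 4 := by
  obtain ⟨h, -⟩ | ⟨h, -⟩ | ⟨h, -⟩ := h <;> omega

theorem Valid.x_mem_interior (h : I.Valid D) : D.x ∈ I.interior D :=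
  mem_interior.2 ⟨h.x_ne_t, .inl rfl⟩

theorem Valid.lt_of_mem {v : ℕ} (h : I.Valid D) (hv : v ∈ I.interior D) : v < I.n := by
  obtain ⟨-, rfl | rfl | rfl⟩ := mem_interior.1 hv
  exacts [h.lt.1, h.lt.2.1, h.lt.2.2]

theorem Valid.ne_s_of_mem {v : ℕ} (h : I.Valid D) (hv : v ∈ I.interior D) : v ≠ I.s := by
  obtain ⟨-, rfl | rfl | rfl⟩ := mem_interior.1 hv
  exacts [h.ne_s.1, h.ne_s.2.1, h.ne_s.2.2]

end ArcInstance

/-! ### Searching for one path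

Registers `0, …, 4` and arrays `0`, `1`, `2` hold the instance. Array `10` holds marked nodes,
registers `10`, `11`, `12` hold three more forbidden nodes, array `11` the resulting set of
forbidden nodes, and array `12 + j` the nodes reached after `j` steps, with their predecessors.
Registers `13, …, 17` hold the path that is found; register `13` is `0` if there is none. -/

namespace RAM

def Cmd.block : List Cmd → Cmd
  | [] => .skip
  | p :: l => .seq p (Cmd.block l)

theorem Run.block_cons {W T T' : ℕ} {p : Cmd} {l : List Cmd} {σ : State} {Q : State → Prop}
    (h : Run W T p σ fun τ => Run W T' (.block l) τ Q) : Run W (T + T') (.block (p :: l)) σ Q :=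
  Run.seq h

theorem Run.block_nil {W : ℕ} {σ : State} {Q : State → Prop} (h : Q σ) :
    Run W 1 (.block []) σ Q := fun _ => ⟨1, σ, .skip σ, le_rfl, h⟩

end RAM

open RAM

namespace ArcInstance

variable (I : ArcInstance)

/-- The memory contains the instance. -/
structure Loaded (σ : State) : Prop where
  n : σ.reg 0 = I.n
  c : σ.reg 1 = I.c
  m : σ.reg 2 = I.m
  s : σ.reg 3 = I.s
  t : σ.reg 4 = I.t
  src : σ.arr 0 = I.src
  dst : σ.arr 1 = I.dst
  col : σ.arr 2 = I.col

variable {I}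

theorem Loaded.congr {σ τ : State} (h : I.Loaded σ) (hr : ∀ r < 5, τ.reg r = σ.reg r)
    (ha : ∀ a < 3, τ.arr a = σ.arr a) : I.Loaded τ :=
  ⟨(hr 0 (by omega)).trans h.n, (hr 1 (by omega)).trans h.c, (hr 2 (by omega)).trans h.m,
    (hr 3 (by omega)).trans h.s, (hr 4 (by omega)).trans h.t, (ha 0 (by omega)).trans h.src,
    (ha 1 (by omega)).trans h.dst, (ha 2 (by omega)).trans h.col⟩

variable (I)

/-- The array `j + 13` contains the ends of the arcs `S a v` from array `j + 12`, together with
their starting points. -/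
def LayerInv (j : ℕ) (S : ℕ → ℕ → Prop) (τ : State) : Prop :=
  (∀ v, τ.arr (j + 13) v = 0 → ∀ a, S a v →
    τ.arr (j + 12) a = 0 ∨ τ.arr 11 v ≠ 0 ∨ a = I.t) ∧
  ∀ v a, v < I.n → τ.arr (j + 13) v = a + 1 →
    S a v ∧ τ.arr (j + 12) a ≠ 0 ∧ τ.arr 11 v = 0 ∧ a ≠ I.t

end ArcInstance

namespace RAM

/-- Relaxes the arc from the node in register 18 to the node in register 19. The predecessor is
stored increased by one, so that 0 means that the node has not been reached. No arc leaves `t`,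
since a path ends there. -/
def arcCmd (j : ℕ) : Cmd :=
  .ite (.read (j + 12) (.reg 18)) (.ite (.read 11 (.reg 19)) .skip
    (.ite (.op .eq (.reg 18) (.reg 4)) .skip
      (.write (j + 13) (.reg 19) (.op .add (.reg 18) (.const 1))))) .skip

/-- An undirected edge of the current colour is relaxed in both directions. -/
def scanBody (j : ℕ) : Cmd :=
  .ite (.op .eq (.read 2 (.reg 7)) (.reg 8)) (.block
    [.assign 18 (.read 0 (.reg 7)), .assign 19 (.read 1 (.reg 7)), arcCmd j,
      .assign 18 (.read 1 (.reg 7)), .assign 19 (.read 0 (.reg 7)), arcCmd j]) .skip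

def scanCmd (j : ℕ) : Cmd := .forTo 7 2 (scanBody j)

theorem scanCmd_keepsReg {j r : ℕ} (h : r ≠ 7 ∧ r ≠ 18 ∧ r ≠ 19) : (scanCmd j).KeepsReg r := by
  simp [scanCmd, scanBody, arcCmd, Cmd.KeepsReg, Cmd.block, h]

theorem scanCmd_keepsArr {j a : ℕ} (h : a ≠ j + 13) : (scanCmd j).KeepsArr a := by
  simp [scanCmd, scanBody, arcCmd, Cmd.KeepsArr, Cmd.block, h]

end RAM

namespace ArcInstance

variable {I : ArcInstance} {W : ℕ}

theorem LayerInv.congr {j : ℕ} {S S' : ℕ → ℕ → Prop} {τ υ : State} (h : I.LayerInv j S τ)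
    (ha : υ.arr = τ.arr) (hS : ∀ a v, S a v ↔ S' a v) : I.LayerInv j S' υ := by
  have : S = S' := by
    ext a v
    exact hS a v
  subst this
  simpa only [LayerInv, ha] using h

/-- An arc that is skipped satisfies one of the three alternatives in the first half of `LayerInv`.
An arc that is not skipped may overwrite an older predecessor, which is harmless because the new one
is equally good. The previous layer and the forbidden set are in other arrays. -/
theorem wp_arcCmd {j : ℕ} {S : ℕ → ℕ → Prop} {τ : State} {Q : State → Prop} (ht : τ.reg 4 = I.t)
    (hW : 1 < W) (hlt : τ.reg 18 + 1 < W) (h : I.LayerInv j S τ)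
    (hQ : ∀ υ : State, υ.reg = τ.reg → (∀ a ≠ j + 13, υ.arr a = τ.arr a) →
      I.LayerInv j (fun a v => S a v ∨ (τ.reg 18 = a ∧ τ.reg 19 = v)) υ → Q υ) :
    (arcCmd j).wp W τ Q := by
  have skip : (τ.arr (j + 12) (τ.reg 18) = 0 ∨ τ.arr 11 (τ.reg 19) ≠ 0 ∨ τ.reg 18 = I.t) → Q τ := by
    intro hskip
    refine hQ τ rfl (fun _ _ => rfl) ⟨?_, ?_⟩
    · rintro v hv a (hS | ⟨rfl, rfl⟩)
      · exact h.1 v hv a hS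
      · exact hskip
    · intro v a hv hva
      obtain ⟨h1, h2⟩ := h.2 v a hv hva
      exact ⟨.inl h1, h2⟩
  simp only [arcCmd, Cmd.wp, Expr.Ok, Expr.eval, BinOp.eval, ht, true_and, and_true, hW, hlt]
  refine ⟨fun h1 => ⟨fun h2 => skip (.inr (.inl h2)), fun h2 => ⟨fun h3 => ?_, fun h3 => ?_⟩⟩,
    fun h1 => skip (.inl h1)⟩
  · exact skip (.inr (.inr (by simpa using h3)))
  · have h3 : τ.reg 18 ≠ I.t := by simpa using h3
    refine hQ _ rfl (fun a ha => by simp [ha]) ⟨?_, ?_⟩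
    · intro v hv a hS
      have hne : v ≠ τ.reg 19 := by
        rintro rfl
        simp at hv
      simp only [State.arr_setArr, if_true, Function.update_of_ne hne] at hv
      have := h.1 v hv a (hS.resolve_right fun hh => hne hh.2.symm)
      simpa using this
    · intro v a hv hva
      by_cases hne : v = τ.reg 19
      · subst hne
        have : τ.reg 18 = a := by simpa using hva
        subst this
        exact ⟨.inr ⟨rfl, rfl⟩, by simpa using h1, by simpa using h2, h3⟩
      · simp only [State.arr_setArr, if_true, Function.update_of_ne hne] at hva
        obtain ⟨h4, h5⟩ := h.2 v a hv hva
        exact ⟨.inl h4, by simpa using h5⟩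

/-- The loop invariant is `LayerInv` for the arcs in the list entries scanned so far. The layer has
to be empty at the start, as stale entries would not have valid predecessors. -/
theorem run_scanCmd {j : ℕ} {σ : State} (hσ : I.Loaded σ) (hW : I.n < W)
    (h0 : ∀ v < I.n, σ.arr (j + 13) v = 0) :
    Run W (I.m * 100 + 6) (scanCmd j) σ (I.LayerInv j (I.Adj (σ.reg 8))) := by
  have hn := I.t_lt
  have hW1 : 1 < W := by have := I.s_lt; have := I.s_ne_t; omega
  have := Run.forTo (T := (scanBody j).time) (σ := σ) (i := 7) (N := 2) (p := scanBody j)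
    (fun k τ => I.LayerInv j (fun a v => ∃ k' < k, I.ArcAt (σ.reg 8) k' a v) τ) hW1
    (by omega) (by simp [scanBody, arcCmd, Cmd.KeepsReg, Cmd.block])
    (by simp [scanBody, arcCmd, Cmd.KeepsReg, Cmd.block]) ?_ ?_
  · rw [hσ.m] at this
    refine this.mono ?_ fun τ _ h => h
    simp only [scanBody, arcCmd, Cmd.time, Cmd.block, Expr.cost]
    omega
  · refine ⟨by simp, fun v a hv hva => ?_⟩
    simp [h0 v hv] at hva
  · intro k τ hk hk7 hr ha hI
    rw [hσ.m] at hk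
    have keepsArr : ∀ {a}, a < 3 → (scanBody j).KeepsArr a := fun ha3 =>
      Cmd.keepsArr_forTo.1 (scanCmd_keepsArr (by omega))
    have keepsReg : ∀ {r}, r ≠ 7 ∧ r ≠ 18 ∧ r ≠ 19 → (scanBody j).KeepsReg r := fun hr7 =>
      (Cmd.keepsReg_forTo.1 (scanCmd_keepsReg hr7)).2
    have hsrc : τ.arr 0 = I.src := (ha 0 (keepsArr (by omega))).trans hσ.src
    have hdst : τ.arr 1 = I.dst := (ha 1 (keepsArr (by omega))).trans hσ.dst
    have hcol : τ.arr 2 = I.col := (ha 2 (keepsArr (by omega))).trans hσ.col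
    have hr4 : τ.reg 4 = I.t :=
      (hr 4 (by omega) (keepsReg (by omega))).trans hσ.t
    have hr8 : τ.reg 8 = σ.reg 8 := hr 8 (by omega) (keepsReg (by omega))
    have h1 := I.src_lt k hk
    have h2 := I.dst_lt k hk
    refine Run.flat hW1 ?_
    simp only [scanBody, Cmd.wp, Cmd.block, Expr.Ok, Expr.eval, BinOp.eval, true_and, hk7, hcol,
      hsrc]
    refine ⟨fun hc => ?_, fun hc => ?_⟩
    · have hc : I.col k = τ.reg 8 := by simpa using hc
      refine wp_arcCmd (S := fun a v => ∃ k' < k, I.ArcAt (σ.reg 8) k' a v) (I := I)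
        (by simpa using hr4) hW1 (by simp; omega) (hI.congr rfl fun _ _ => Iff.rfl) fun υ hυ hυa hυI => ?_
      simp [hk7, hdst] at hυI
      have e0 : υ.arr 0 = I.src := (hυa 0 (by omega)).trans hsrc
      have e1 : υ.arr 1 = I.dst := (hυa 1 (by omega)).trans hdst
      refine wp_arcCmd (I := I) (by simpa [hυ] using hr4) hW1 (by simp [e1, hυ, hk7]; omega)
        (hυI.congr (by simp) fun _ _ => Iff.rfl) fun φ hφ hφa hφI => ?_
      refine hφI.congr (by simp) fun a v => ?_
      simp only [State.reg_setReg, hυ, hk7, State.arr_setReg, e0, e1]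
      simp only [ArcAt, Nat.lt_succ_iff_lt_or_eq, or_and_right, exists_or, exists_eq_left,
        hc, hr8, true_and]
      simp [or_assoc]
    · have hc : I.col k ≠ τ.reg 8 := by simpa using hc
      refine hI.congr (by simp) fun a v => ?_
      simp only [Nat.lt_succ_iff_lt_or_eq, or_and_right, exists_or, exists_eq_left, ArcAt, ← hr8,
        hc, false_and, or_false]

end ArcInstance

namespace RAM

def resetCmd : Cmd := .forTo 7 0 (.block
  [.write 12 (.reg 7) (.const 0), .write 13 (.reg 7) (.const 0), .write 14 (.reg 7) (.const 0),
    .write 15 (.reg 7) (.const 0), .write 16 (.reg 7) (.const 0)])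

/-- The layers 2, 3, 4 are tested for `t` in this order, so a shortest length is chosen, and the
nodes are read off backwards along the predecessors. -/
def extractCmd : Cmd := .block
  [.assign 14 (.reg 8),
    .ite (.read 14 (.reg 4)) (.block
      [.assign 13 (.const 2), .assign 15 (.op .sub (.read 14 (.reg 4)) (.const 1)),
        .assign 16 (.reg 4), .assign 17 (.reg 4)])
    (.ite (.read 15 (.reg 4)) (.block
      [.assign 13 (.const 3), .assign 16 (.op .sub (.read 15 (.reg 4)) (.const 1)),
        .assign 15 (.op .sub (.read 14 (.reg 16)) (.const 1)), .assign 17 (.reg 4)])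
    (.ite (.read 16 (.reg 4)) (.block
      [.assign 13 (.const 4), .assign 17 (.op .sub (.read 16 (.reg 4)) (.const 1)),
        .assign 16 (.op .sub (.read 15 (.reg 17)) (.const 1)),
        .assign 15 (.op .sub (.read 14 (.reg 16)) (.const 1))]) .skip))]

/-- Search for a path of the colour in register `8`. -/
def colorCmd : Cmd := .block
  [resetCmd, .write 12 (.reg 3) (.const 1), scanCmd 0, scanCmd 1, scanCmd 2, scanCmd 3, extractCmd]

/-- The mark of `t` is cleared last: `t` serves as padding in registers 10, 11, 12 and may be marked
in array 10, but it has to remain reachable. -/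
def blockedCmd : Cmd := .block
  [.forTo 7 0 (.write 11 (.reg 7) (.read 10 (.reg 7))), .write 11 (.reg 10) (.const 1),
    .write 11 (.reg 11) (.const 1), .write 11 (.reg 12) (.const 1), .write 11 (.reg 4) (.const 0),
    .assign 13 (.const 0)]

def searchCmd : Cmd := .block
  [blockedCmd, .forTo 8 1 (.ite (.reg 13) .skip colorCmd)]

/-- The path that is stored in the registers `b, …, b + 4`. -/
def State.path (σ : State) (b : ℕ) : PathData :=
  ⟨σ.reg b, σ.reg (b + 1), σ.reg (b + 2), σ.reg (b + 3), σ.reg (b + 4)⟩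

theorem resetCmd_keepsReg {r : ℕ} (h : r ≠ 7) : resetCmd.KeepsReg r := by
  simp [resetCmd, Cmd.KeepsReg, Cmd.block, h]

theorem resetCmd_keepsArr {a : ℕ} (h : a < 12) : resetCmd.KeepsArr a := by
  simp only [resetCmd, Cmd.keepsArr_forTo, Cmd.KeepsArr, Cmd.block, and_true]
  omega

theorem extractCmd_keepsReg {r : ℕ} (h : r < 13 ∨ 18 ≤ r) : extractCmd.KeepsReg r := by
  simp only [extractCmd, Cmd.KeepsReg, Cmd.block, and_true]
  omega

theorem extractCmd_keepsArr {a : ℕ} : extractCmd.KeepsArr a := by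
  simp only [extractCmd, Cmd.KeepsArr, Cmd.block, and_self]

theorem colorCmd_keepsReg {r : ℕ} (h : r < 13 ∨ 20 ≤ r) (h7 : r ≠ 7) : colorCmd.KeepsReg r :=
  ⟨resetCmd_keepsReg h7, trivial, scanCmd_keepsReg (by omega), scanCmd_keepsReg (by omega),
    scanCmd_keepsReg (by omega), scanCmd_keepsReg (by omega), extractCmd_keepsReg (by omega),
    trivial⟩

theorem colorCmd_keepsArr {a : ℕ} (h : a < 12) : colorCmd.KeepsArr a :=
  ⟨resetCmd_keepsArr h, h.ne, scanCmd_keepsArr (by omega), scanCmd_keepsArr (by omega),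
    scanCmd_keepsArr (by omega), scanCmd_keepsArr (by omega), extractCmd_keepsArr, trivial⟩

theorem blockedCmd_keepsReg {r : ℕ} (h : r ≠ 7 ∧ r ≠ 13) : blockedCmd.KeepsReg r := by
  simp [blockedCmd, Cmd.KeepsReg, Cmd.block, h]

theorem blockedCmd_keepsArr {a : ℕ} (h : a ≠ 11) : blockedCmd.KeepsArr a := by
  simp [blockedCmd, Cmd.KeepsArr, Cmd.block, h]

theorem searchCmd_keepsReg {r : ℕ} (h : r < 13 ∨ 20 ≤ r) (h7 : r ≠ 7) (h8 : r ≠ 8) :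
    searchCmd.KeepsReg r :=
  ⟨blockedCmd_keepsReg (by omega), Cmd.keepsReg_forTo.2 ⟨h8, trivial, colorCmd_keepsReg h h7⟩,
    trivial⟩

theorem searchCmd_keepsArr {a : ℕ} (h : a < 11) : searchCmd.KeepsArr a :=
  ⟨blockedCmd_keepsArr (by omega), Cmd.keepsArr_forTo.2 ⟨trivial, colorCmd_keepsArr (by omega)⟩,
    trivial⟩

end RAM

/-! ### Correctness and running time of the search for one path -/

namespace ArcInstance

variable {I : ArcInstance} {W : ℕ}

variable (I) in
def Avoids (X : ℕ → Prop) (D : PathData) : Prop := ∀ v ∈ I.interior D, ¬ X v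

theorem avoids_iff {X : ℕ → Prop} {D : PathData} :
    I.Avoids X D ↔ (D.x ≠ I.t → ¬ X D.x) ∧ (D.y ≠ I.t → ¬ X D.y) ∧ (D.z ≠ I.t → ¬ X D.z) := by
  simp only [Avoids, mem_interior]
  constructor
  · exact fun h => ⟨fun h1 => h _ ⟨h1, .inl rfl⟩, fun h1 => h _ ⟨h1, .inr (.inl rfl)⟩,
      fun h1 => h _ ⟨h1, .inr (.inr rfl)⟩⟩
  · rintro ⟨h1, h2, h3⟩ v ⟨hv, rfl | rfl | rfl⟩
    exacts [h1 hv, h2 hv, h3 hv]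

variable (I) in
/-- Registers `13, …, 17` contain a path with a colour in `C` that avoids `X`, or register `13`
contains `0` and there is no such path. -/
def SearchResult (C X : ℕ → Prop) (τ : State) : Prop :=
  (τ.reg 13 = 0 ∧ ∀ D, I.Valid D → C D.col → ¬ I.Avoids X D) ∨
    (τ.reg 13 ≠ 0 ∧ I.Valid (τ.path 13) ∧ I.Avoids X (τ.path 13))

/-- The layers record walks, and it has to be seen that the walk found is a path: `s` is forbidden
and so never revisited, `t` is never left, and a repetition x = z would have put `t` into layer 2,
which was tested before. Conversely, the nodes of a path avoiding the forbidden set appear in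
successive layers. -/
theorem wp_extractCmd {τ : State} (hτ : I.Loaded τ) (hW : I.n + I.c + I.m + 4 < W)
    (h13 : τ.reg 13 = 0) (hs : τ.arr 11 I.s ≠ 0) (ht : τ.arr 11 I.t = 0)
    (h0 : ∀ v < I.n, τ.arr 12 v ≠ 0 ↔ v = I.s)
    (hL : ∀ j < 4, I.LayerInv j (I.Adj (τ.reg 8)) τ) :
    extractCmd.wp W τ (I.SearchResult (fun i => i = τ.reg 8) fun v => τ.arr 11 v ≠ 0) := by
  have hst := I.s_ne_t
  have up : ∀ j < 4, ∀ a v, τ.arr (j + 12) a ≠ 0 → I.Adj (τ.reg 8) a v → τ.arr 11 v = 0 →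
      a ≠ I.t → τ.arr (j + 13) v ≠ 0 := by
    intro j hj a v h1 h2 h3 h4 h5
    have := (hL j hj).1 v h5 a h2
    tauto
  have down : ∀ j < 4, ∀ v < I.n, τ.arr (j + 13) v ≠ 0 → ∃ a, τ.arr (j + 13) v = a + 1 ∧
      I.Adj (τ.reg 8) a v ∧ τ.arr (j + 12) a ≠ 0 ∧ τ.arr 11 v = 0 ∧ a ≠ I.t := by
    intro j hj v hv h
    obtain ⟨a, ha⟩ := Nat.exists_eq_succ_of_ne_zero h
    exact ⟨a, ha, (hL j hj).2 v a hv ha⟩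
  have up0 : ∀ v, I.Adj (τ.reg 8) I.s v → τ.arr 11 v = 0 → τ.arr 13 v ≠ 0 := fun v h1 h2 =>
    up 0 (by omega) I.s v ((h0 _ I.s_lt).2 rfl) h1 h2 hst
  have down0 : ∀ v < I.n, τ.arr 13 v ≠ 0 → I.Adj (τ.reg 8) I.s v ∧ τ.arr 11 v = 0 := by
    intro v hv h
    obtain ⟨a, -, h2, h3, h4, -⟩ := down 0 (by omega) v hv h
    obtain rfl := (h0 a h2.lt_left).1 h3
    exact ⟨h2, h4⟩
  have hsblk : ∀ v, τ.arr 11 v = 0 → v ≠ I.s := by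
    rintro v hv rfl
    exact hs hv
  simp only [extractCmd, Cmd.wp, Cmd.block, Expr.Ok, Expr.eval, BinOp.eval, true_and,
    State.reg_setReg, State.arr_setReg, hτ.t]
  simp only [show 2 < W by omega, show 1 < W by omega, show 3 < W by omega, show 4 < W by omega,
    true_and, if_true, Nat.reduceEqDiff, if_false]
  refine ⟨fun h2 => ?_, fun h2 => ⟨fun h3 => ?_, fun h3 => ⟨fun h4 => ?_, fun h4 => ?_⟩⟩⟩
  · obtain ⟨x, hx, hxt, hlx, -, hne⟩ := down 1 (by omega) _ I.t_lt h2
    obtain ⟨hsx, hbx⟩ := down0 x hxt.lt_left hlx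
    refine .inr ⟨by simp, ?_, ?_⟩
    · refine .inl ?_
      simp [State.path, hx, hsx, hxt]
    · simp [avoids_iff, State.path, hx, hbx]
  · obtain ⟨y, hy, hyt, hly, -, hyne⟩ := down 2 (by omega) _ I.t_lt h3
    obtain ⟨x, hx, hxy, hlx, hby, hxne⟩ := down 1 (by omega) _ hyt.lt_left hly
    obtain ⟨hsx, hbx⟩ := down0 x hxy.lt_left hlx
    refine .inr ⟨by simp, ?_, ?_⟩
    · refine .inr (.inl ?_)
      simp [State.path, hy, hx, hsx, hxy, hyt, hxne, hsblk y hby]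
    · simp [avoids_iff, State.path, hy, hx, hbx, hby]
  · obtain ⟨z, hz, hzt, hlz, -, hzne⟩ := down 3 (by omega) _ I.t_lt h4
    obtain ⟨y, hy, hyz, hly, hbz, hyne⟩ := down 2 (by omega) _ hzt.lt_left hlz
    obtain ⟨x, hx, hxy, hlx, hby, hxne⟩ := down 1 (by omega) _ hyz.lt_left hly
    obtain ⟨hsx, hbx⟩ := down0 x hxy.lt_left hlx
    refine .inr ⟨by simp, ?_, ?_⟩
    · refine .inr (.inr ?_)
      simp [State.path, hz, hy, hx, hsx, hxy, hyz, hzt, hxne, hyne, hsblk y hby, hsblk z hbz]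
      -- If x = z, then `t` is reached in two steps, against the failure of the first test.
      rintro rfl
      exact up 1 (by omega) _ _ hlx hzt ht hxne h2
    · simp [avoids_iff, State.path, hz, hy, hx, hbx, hby, hbz]
  · refine .inl ⟨by simpa using h13, ?_⟩
    rintro D hD hC hav
    obtain ⟨hx, hy, hz⟩ := avoids_iff.1 hav
    have hC : D.col = τ.reg 8 := hC
    rw [Valid, hC] at hD
    obtain ⟨-, h5, h6, h7, h8⟩ | ⟨-, h5, h6, h7, h8, h9, h10⟩ |
      ⟨-, h5, h6, h7, h8, h9, h10, h11, h12, h13⟩ := hD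
    · exact up 1 (by omega) _ _ (up0 _ h5 (by simpa using hx h6.ne)) h6 ht h6.ne h2
    · exact up 2 (by omega) _ _ (up 1 (by omega) _ _ (up0 _ h5 (by simpa using hx h9)) h6
        (by simpa using hy h7.ne) h9) h7 ht h7.ne h3
    · exact up 3 (by omega) _ _ (up 2 (by omega) _ _ (up 1 (by omega) _ _
        (up0 _ h5 (by simpa using hx h9)) h6 (by simpa using hy h11) h9) h7
        (by simpa using hz h8.ne) h11) h8 ht h8.ne h4

end ArcInstance

namespace RAM

theorem Run.next {W T T' : ℕ} {p : Cmd} {l : List Cmd} {σ : State} {Q Q' : State → Prop}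
    (h : Run W T p σ Q)
    (h' : ∀ τ, Q τ → (∀ r, p.KeepsReg r → τ.reg r = σ.reg r) →
      (∀ a, p.KeepsArr a → τ.arr a = σ.arr a) → Run W T' (.block l) τ Q') :
    Run W (T + T') (.block (p :: l)) σ Q' :=
  Run.block_cons (h.frame.mono le_rfl fun τ _ hτ => h' τ hτ.1 hτ.2.1 hτ.2.2)

end RAM

namespace ArcInstance

variable {I : ArcInstance} {W : ℕ} {σ : State}

theorem run_resetCmd (hσ : I.Loaded σ) (hW : I.n + I.c + I.m + 4 < W) :
    Run W (I.n * 100 + 6) resetCmd σ fun τ => ∀ v < I.n, ∀ j < 5, τ.arr (j + 12) v = 0 := by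
  have hW1 : 1 < W := by omega
  have := Run.forTo (σ := σ) (i := 7) (N := 0) (T := 16) (p := .block
    [.write 12 (.reg 7) (.const 0), .write 13 (.reg 7) (.const 0), .write 14 (.reg 7) (.const 0),
      .write 15 (.reg 7) (.const 0), .write 16 (.reg 7) (.const 0)])
    (fun k τ => ∀ v < k, τ.arr 12 v = 0 ∧ τ.arr 13 v = 0 ∧ τ.arr 14 v = 0 ∧ τ.arr 15 v = 0 ∧
      τ.arr 16 v = 0) hW1
    (by omega) (by simp [Cmd.KeepsReg, Cmd.block]) (by simp [Cmd.KeepsReg, Cmd.block])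
    (by simp) ?_
  · rw [hσ.n] at this
    refine this.mono (by omega) fun τ _ h v hv j hj => ?_
    obtain ⟨h0, h1, h2, h3, h4⟩ := h v hv
    interval_cases j <;> assumption
  · intro k τ hk hk7 hr ha hI
    refine Run.flat hW1 ?_
    simp only [Cmd.wp, Cmd.block, Expr.Ok, Expr.eval, true_and, State.reg_setArr, hk7,
      show 0 < W by omega]
    intro v hv
    by_cases hvk : v = k
    · subst hvk
      simp
    · simpa [hvk] using hI v (by omega)

/-- Each scan writes to its own layer only, so the invariants of the earlier layers survive until
the extraction. -/
theorem run_colorCmd (hσ : I.Loaded σ) (hW : I.n + I.c + I.m + 4 < W)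
    (h13 : σ.reg 13 = 0) (hs : σ.arr 11 I.s ≠ 0) (ht : σ.arr 11 I.t = 0) :
    Run W (I.n * 100 + I.m * 400 + 200) colorCmd σ
      (I.SearchResult (fun i => i = σ.reg 8) fun v => σ.arr 11 v ≠ 0) := by
  have hW1 : 1 < W := by omega
  refine Run.le (T := (I.n * 100 + 6) + (3 + ((I.m * 100 + 6) + ((I.m * 100 + 6) +
    ((I.m * 100 + 6) + ((I.m * 100 + 6) + (extractCmd.time + 1))))))) ?_ ?_
  swap
  · simp only [extractCmd, Cmd.time, Cmd.block, Expr.cost]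
    omega
  refine (run_resetCmd hσ hW).next fun τ0 h0 hr0 ha0 => ?_
  have hL0 : I.Loaded τ0 := hσ.congr (fun r hr => hr0 r (resetCmd_keepsReg (by omega)))
    fun a ha => ha0 a (resetCmd_keepsArr (by omega))
  refine Run.next (p := .write 12 (.reg 3) (.const 1))
    (Q := fun τ => τ = τ0.setArr 12 I.s 1) ?_ ?_
  · refine Run.flat hW1 ?_
    simp [Cmd.wp, Expr.Ok, Expr.eval, hL0.s, hW1]
  rintro τ1 rfl - -
  set τ1 := τ0.setArr 12 I.s 1 with hτ1
  have hL1 : I.Loaded τ1 := hL0.congr (fun _ _ => rfl) fun a ha => by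
    simp [hτ1, show a ≠ 12 by omega]
  have hz : ∀ v < I.n, ∀ j < 4, τ1.arr (j + 13) v = 0 := fun v hv j hj => by
    simpa [hτ1] using h0 v hv (j + 1) (by omega)
  have h12 : ∀ v < I.n, τ1.arr 12 v ≠ 0 ↔ v = I.s := fun v hv => by
    by_cases hvs : v = I.s
    · simp [hτ1, hvs]
    · simpa [hτ1, hvs] using h0 v hv 0 (by omega)
  have hr1 : ∀ r, r ≠ 7 → τ1.reg r = σ.reg r := fun r hr => hr0 r (resetCmd_keepsReg hr)
  have h11 : τ1.arr 11 = σ.arr 11 := by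
    simpa [hτ1] using ha0 11 (resetCmd_keepsArr (by omega))
  refine (run_scanCmd hL1 (by omega) fun v hv => hz v hv 0 (by omega)).next
    fun τ2 hI2 hr2 ha2 => ?_
  have hL2 : I.Loaded τ2 := hL1.congr (fun r hr => hr2 r (scanCmd_keepsReg (by omega)))
    fun a ha => ha2 a (scanCmd_keepsArr (by omega))
  refine (run_scanCmd hL2 (by omega) fun v hv => ?_).next fun τ3 hI3 hr3 ha3 => ?_
  · rw [ha2 _ (scanCmd_keepsArr (by omega))]
    exact hz v hv 1 (by omega)
  have hL3 : I.Loaded τ3 := hL2.congr (fun r hr => hr3 r (scanCmd_keepsReg (by omega)))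
    fun a ha => ha3 a (scanCmd_keepsArr (by omega))
  refine (run_scanCmd hL3 (by omega) fun v hv => ?_).next fun τ4 hI4 hr4 ha4 => ?_
  · rw [ha3 _ (scanCmd_keepsArr (by omega)), ha2 _ (scanCmd_keepsArr (by omega))]
    exact hz v hv 2 (by omega)
  have hL4 : I.Loaded τ4 := hL3.congr (fun r hr => hr4 r (scanCmd_keepsReg (by omega)))
    fun a ha => ha4 a (scanCmd_keepsArr (by omega))
  refine (run_scanCmd hL4 (by omega) fun v hv => ?_).next fun τ5 hI5 hr5 ha5 => ?_
  · rw [ha4 _ (scanCmd_keepsArr (by omega)), ha3 _ (scanCmd_keepsArr (by omega)),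
      ha2 _ (scanCmd_keepsArr (by omega))]
    exact hz v hv 3 (by omega)
  have hL5 : I.Loaded τ5 := hL4.congr (fun r hr => hr5 r (scanCmd_keepsReg (by omega)))
    fun a ha => ha5 a (scanCmd_keepsArr (by omega))
  have e8 : τ1.reg 8 = σ.reg 8 := hr1 8 (by omega)
  have hr52 : ∀ r, r ≠ 7 ∧ r ≠ 18 ∧ r ≠ 19 → τ5.reg r = σ.reg r ∧ τ4.reg r = σ.reg r ∧
      τ3.reg r = σ.reg r ∧ τ2.reg r = σ.reg r := fun r hr => by
    rw [hr5 r (scanCmd_keepsReg hr), hr4 r (scanCmd_keepsReg hr), hr3 r (scanCmd_keepsReg hr),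
      hr2 r (scanCmd_keepsReg hr), hr1 r hr.1]
    simp
  obtain ⟨e85, e84, e83, e82⟩ := hr52 8 (by omega)
  have a11 : τ5.arr 11 = σ.arr 11 ∧ τ4.arr 11 = σ.arr 11 ∧ τ3.arr 11 = σ.arr 11 ∧
      τ2.arr 11 = σ.arr 11 := by
    rw [ha5 _ (scanCmd_keepsArr (by omega)), ha4 _ (scanCmd_keepsArr (by omega)),
      ha3 _ (scanCmd_keepsArr (by omega)), ha2 _ (scanCmd_keepsArr (by omega)), h11]
    simp
  obtain ⟨a115, a114, a113, a112⟩ := a11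
  refine Run.next (Run.flat hW1 (wp_extractCmd hL5 hW ?_ ?_ ?_ ?_ ?_)) fun τ6 h6 _ _ =>
    Run.block_nil ?_
  · rw [(hr52 13 (by omega)).1, h13]
  · rwa [a115]
  · rwa [a115]
  · rw [ha5 _ (scanCmd_keepsArr (by omega)), ha4 _ (scanCmd_keepsArr (by omega)),
      ha3 _ (scanCmd_keepsArr (by omega)), ha2 _ (scanCmd_keepsArr (by omega))]
    exact h12
  · intro j hj
    rw [e85]
    rw [e8] at hI2
    rw [e82] at hI3
    rw [e83] at hI4
    rw [e84] at hI5
    interval_cases j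
    · simp only [LayerInv, zero_add] at hI2 ⊢
      rwa [ha5 13 (scanCmd_keepsArr (by omega)), ha4 13 (scanCmd_keepsArr (by omega)),
        ha3 13 (scanCmd_keepsArr (by omega)), ha5 12 (scanCmd_keepsArr (by omega)),
        ha4 12 (scanCmd_keepsArr (by omega)), ha3 12 (scanCmd_keepsArr (by omega)), a115, ← a112]
    · simp only [LayerInv] at hI3 ⊢
      rwa [ha5 (1 + 13) (scanCmd_keepsArr (by omega)), ha4 (1 + 13) (scanCmd_keepsArr (by omega)),
        ha5 (1 + 12) (scanCmd_keepsArr (by omega)),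
        ha4 (1 + 12) (scanCmd_keepsArr (by omega)), a115, ← a113]
    · simp only [LayerInv] at hI4 ⊢
      rwa [ha5 (2 + 13) (scanCmd_keepsArr (by omega)), ha5 (2 + 12) (scanCmd_keepsArr (by omega)),
        a115, ← a114]
    · exact hI5
  · simpa only [e85, a115] using h6

theorem run_blockedCmd (hσ : I.Loaded σ) (hW : I.n + I.c + I.m + 4 < W) (hs : σ.arr 10 I.s ≠ 0) :
    Run W (I.n * 100 + 50) blockedCmd σ fun τ => τ.reg 13 = 0 ∧ τ.arr 11 I.t = 0 ∧
      τ.arr 11 I.s ≠ 0 ∧ ∀ v < I.n, v ≠ I.t → (τ.arr 11 v ≠ 0 ↔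
        (σ.arr 10 v ≠ 0 ∨ v = σ.reg 10 ∨ v = σ.reg 11 ∨ v = σ.reg 12)) := by
  have hW1 : 1 < W := by omega
  refine Run.le (T := (I.n * (4 + 8) + 6) + (Cmd.time (.block [.write 11 (.reg 10) (.const 1),
    .write 11 (.reg 11) (.const 1), .write 11 (.reg 12) (.const 1), .write 11 (.reg 4) (.const 0),
    .assign 13 (.const 0)]))) ?_ ?_
  swap
  · simp only [Cmd.time, Cmd.block, Expr.cost]
    omega
  have := Run.forTo (σ := σ) (i := 7) (N := 0) (T := 4) (W := W)
    (p := .write 11 (.reg 7) (.read 10 (.reg 7)))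
    (fun k τ => ∀ v < k, τ.arr 11 v = σ.arr 10 v) hW1
    (by omega) (by simp [Cmd.KeepsReg]) (by simp [Cmd.KeepsReg]) (by simp) ?_
  · rw [hσ.n] at this
    refine this.next fun τ h hr ha => Run.flat hW1 ?_
    have e : ∀ r, r ≠ 7 → τ.reg r = σ.reg r := fun r hr7 => hr r (by simp [Cmd.KeepsReg, hr7])
    simp only [Cmd.wp, Cmd.block, Expr.Ok, Expr.eval, true_and, State.reg_setArr, hW1,
      show 0 < W by omega, e 10 (by omega), e 11 (by omega), e 12 (by omega), e 4 (by omega),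
      hσ.t]
    have key : ∀ v < I.n, v ≠ I.t → ((((((τ.setArr 11 (σ.reg 10) 1).setArr 11 (σ.reg 11) 1).setArr
        11 (σ.reg 12) 1).setArr 11 I.t 0).setReg 13 0).arr 11 v ≠ 0 ↔
        (σ.arr 10 v ≠ 0 ∨ v = σ.reg 10 ∨ v = σ.reg 11 ∨ v = σ.reg 12)) := by
      intro v hv hvt
      simp only [State.arr_setReg, State.arr_setArr, if_true, Function.update_apply, hvt, if_false,
        h v hv]
      split_ifs <;> simp_all
    refine ⟨by simp, by simp, ?_, key⟩
    exact (key _ I.s_lt I.s_ne_t).2 (.inl hs)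
  · intro k τ hk hk7 hr ha hI
    refine Run.flat hW1 ?_
    simp only [Cmd.wp, Expr.Ok, Expr.eval, true_and, hk7]
    intro v hv
    by_cases hvk : v = k
    · subst hvk
      simp [ha 10 (by simp [Cmd.KeepsArr])]
    · simpa [hvk] using hI v (by omega)

variable (I) in
/-- The number of steps of a search. -/
def searchTime : ℕ := I.c * (I.n + I.m) * 1000

/-- The invariant is `SearchResult` for the colours below the loop counter; once a path is found,
the remaining rounds do nothing. -/
theorem run_searchCmd (hσ : I.Loaded σ) (hW : I.n + I.c + I.m + 4 < W) (hs : σ.arr 10 I.s ≠ 0) :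
    Run W I.searchTime searchCmd σ (I.SearchResult (fun _ => True) fun v =>
      σ.arr 10 v ≠ 0 ∨ v = σ.reg 10 ∨ v = σ.reg 11 ∨ v = σ.reg 12) := by
  have hW1 : 1 < W := by omega
  have hcn : I.n ≤ I.c * I.n := Nat.le_mul_of_pos_left _ I.c_pos
  have hcn' : I.c ≤ I.c * I.n := Nat.le_mul_of_pos_right _ (by have := I.t_lt; omega)
  refine Run.le (T := (I.n * 100 + 50) + ((I.c * ((I.n * 100 + I.m * 400 + 202) + 8) + 6) + 1))
    ?_ ?_
  swap
  · have h3 : I.c * ((I.n * 100 + I.m * 400 + 202) + 8) =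
      I.c * I.n * 100 + I.c * I.m * 400 + I.c * 210 := by ring
    have h4 : I.searchTime = I.c * I.n * 1000 + I.c * I.m * 1000 := by
      simp only [searchTime]
      ring
    have := I.c_pos
    have := I.t_lt
    omega
  refine (run_blockedCmd hσ hW hs).next fun τ h hr ha => ?_
  obtain ⟨h13, ht, hs', hX⟩ := h
  have hL : I.Loaded τ := hσ.congr (fun r hr' => hr r (blockedCmd_keepsReg (by omega)))
    fun a ha' => ha a (blockedCmd_keepsArr (by omega))
  have := Run.forTo (σ := τ) (i := 8) (N := 1) (T := I.n * 100 + I.m * 400 + 202) (W := W)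
    (p := .ite (.reg 13) .skip colorCmd)
    (fun k υ => I.SearchResult (· < k) (fun v => τ.arr 11 v ≠ 0) υ) hW1
    (by omega) ⟨trivial, colorCmd_keepsReg (by omega) (by omega)⟩
    ⟨trivial, colorCmd_keepsReg (by omega) (by omega)⟩ (.inl ⟨by simpa using h13, by simp⟩) ?_
  · rw [hL.c] at this
    refine this.next fun υ h _ _ => Run.block_nil ?_
    -- Array 11 describes the forbidden set only for nodes below `n` other than `t`, which covers
    -- all internal nodes.
    have hav : ∀ D, I.Valid D → (I.Avoids (fun v => τ.arr 11 v ≠ 0) D ↔ I.Avoids (fun v =>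
      σ.arr 10 v ≠ 0 ∨ v = σ.reg 10 ∨ v = σ.reg 11 ∨ v = σ.reg 12) D) := fun D hD =>
      forall₂_congr fun v hv => not_congr (hX v (hD.lt_of_mem hv) (mem_interior.1 hv).1)
    obtain ⟨h1, h2⟩ | ⟨h1, h2, h3⟩ := h
    · exact .inl ⟨h1, fun D hD _ h => h2 D hD hD.col_lt ((hav D hD).2 h)⟩
    · exact .inr ⟨h1, h2, (hav _ h2).1 h3⟩
  · intro k υ hk hk8 hr' ha' hI
    have e11 : υ.arr 11 = τ.arr 11 := ha' 11 ⟨trivial, colorCmd_keepsArr (by omega)⟩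
    have hL' : I.Loaded υ := hL.congr
      (fun r hr5 => hr' r (by omega) ⟨trivial, colorCmd_keepsReg (by omega) (by omega)⟩)
      fun a ha5 => ha' a ⟨trivial, colorCmd_keepsArr (by omega)⟩
    refine Run.le (T := Expr.cost (.reg 13) + 1 + (I.n * 100 + I.m * 400 + 200)) ?_
      (by simp only [Expr.cost]; omega)
    refine Run.ite hW1 trivial (fun h0 => ?_) fun h0 => ?_
    · have h0 : υ.reg 13 ≠ 0 := h0
      refine (Run.flat hW1 (p := .skip) (Q := (· = υ)) rfl).mono
        (by simp only [Cmd.time]; omega) ?_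
      rintro _ _ rfl
      obtain ⟨h1, h2⟩ | h1 := hI
      · exact absurd h1 h0
      · exact .inr (by simpa [State.path] using h1)
    · have h0 : υ.reg 13 = 0 := h0
      refine (run_colorCmd hL' hW h0 (by rwa [e11]) (by rwa [e11])).mono le_rfl
        fun φ _ hφ => ?_
      rw [e11, hk8] at hφ
      obtain ⟨h1, h2⟩ | ⟨h1, -⟩ := hI
      swap
      · exact absurd h0 h1
      obtain ⟨h3, h4⟩ | h3 := hφ
      · refine .inl ⟨by simpa using h3, fun D hD hC => ?_⟩
        obtain hC | hC := Nat.lt_succ_iff_lt_or_eq.1 hC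
        · exact h2 D hD hC
        · exact h4 D hD hC
      · exact .inr (by simpa [State.path] using h3)

end ArcInstance

/-! ### Searching for two disjoint paths

Register `20` records success; the paths that are found are stored from registers `24` and `13` on.
Level `d` of the search stores three nodes that the second path has to contain in the registers from
`30 + 10 * d` on, followed by a candidate for the first path. -/

namespace RAM

def copyCmd (b b' : ℕ) : Cmd := .block
  [.assign b' (.reg b), .assign (b' + 1) (.reg (b + 1)), .assign (b' + 2) (.reg (b + 2)),
    .assign (b' + 3) (.reg (b + 3)), .assign (b' + 4) (.reg (b + 4))]

def assignThree (b x y z : ℕ) : Cmd := .block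
  [.assign b (.reg x), .assign (b + 1) (.reg y), .assign (b + 2) (.reg z)]

/-- The first search looks for a candidate that avoids the marked and the required nodes, the second
for a path that avoids the marked nodes and this candidate. The program `p` branches on the
candidate when the second search fails. Nothing is done once register 20 signals success. -/
def branchStep (b : ℕ) (p : Cmd) : Cmd := .ite (.reg 20) .skip (.block
  [assignThree 10 b (b + 1) (b + 2), searchCmd, .ite (.reg 13) (.block
    [copyCmd 13 (b + 3), assignThree 10 15 16 17, searchCmd, .ite (.reg 13) (.block
      [.assign 20 (.const 1), copyCmd (b + 3) 24]) p]) .skip])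

/-- Here `d` is the remaining depth. At level `d` the first 3 - `d` required nodes are genuine and
the others padding; so passing on a node of the candidate together with only the first two required
nodes loses nothing. -/
def branchCmd : ℕ → Cmd
  | 0 => branchStep 30 .skip
  | d + 1 => branchStep (40 + 10 * d) (.block
      [assignThree (30 + 10 * d) (45 + 10 * d) (40 + 10 * d) (41 + 10 * d), branchCmd d,
        assignThree (30 + 10 * d) (46 + 10 * d) (40 + 10 * d) (41 + 10 * d), branchCmd d,
        assignThree (30 + 10 * d) (47 + 10 * d) (40 + 10 * d) (41 + 10 * d), branchCmd d])

theorem copyCmd_keepsReg {b b' r : ℕ} (h : r < b' ∨ b' + 5 ≤ r) : (copyCmd b b').KeepsReg r := by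
  simp only [copyCmd, Cmd.KeepsReg, Cmd.block, and_true]
  omega

theorem assignThree_keepsReg {b x y z r : ℕ} (h : r < b ∨ b + 3 ≤ r) :
    (assignThree b x y z).KeepsReg r := by
  simp only [assignThree, Cmd.KeepsReg, Cmd.block, and_true]
  omega

theorem copyCmd_keepsArr {b b' a : ℕ} : (copyCmd b b').KeepsArr a := by
  simp only [copyCmd, Cmd.KeepsArr, Cmd.block, and_true]

theorem assignThree_keepsArr {b x y z a : ℕ} : (assignThree b x y z).KeepsArr a := by
  simp only [assignThree, Cmd.KeepsArr, Cmd.block, and_true]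

theorem branchStep_keepsReg {b r : ℕ} {p : Cmd} (hp : p.KeepsReg r)
    (h : r < 7 ∨ 30 ≤ r) (hb : r < b + 3 ∨ b + 8 ≤ r) : (branchStep b p).KeepsReg r :=
  ⟨trivial, assignThree_keepsReg (by omega), searchCmd_keepsReg (by omega) (by omega) (by omega),
    ⟨⟨copyCmd_keepsReg (by omega), assignThree_keepsReg (by omega),
      searchCmd_keepsReg (by omega) (by omega) (by omega),
      ⟨⟨show r ≠ 20 by omega, copyCmd_keepsReg (by omega), trivial⟩, hp⟩, trivial⟩, trivial⟩,
    trivial⟩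

theorem branchCmd_keepsReg {r : ℕ} : ∀ {d : ℕ},
    r < 7 ∨ 40 + 10 * d ≤ r ∨ (30 + 10 * d ≤ r ∧ r < 33 + 10 * d) → (branchCmd d).KeepsReg r
  | 0, h => branchStep_keepsReg trivial (by omega) (by omega)
  | d + 1, h => by
    have : (branchCmd d).KeepsReg r := branchCmd_keepsReg (by omega)
    exact branchStep_keepsReg ⟨assignThree_keepsReg (by omega), this,
      assignThree_keepsReg (by omega), this, assignThree_keepsReg (by omega), this, trivial⟩
      (by omega) (by omega)

theorem branchStep_keepsArr {b a : ℕ} {p : Cmd} (hp : p.KeepsArr a) (h : a < 11) :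
    (branchStep b p).KeepsArr a :=
  ⟨trivial, assignThree_keepsArr, searchCmd_keepsArr h,
    ⟨⟨copyCmd_keepsArr, assignThree_keepsArr, searchCmd_keepsArr h,
      ⟨⟨trivial, copyCmd_keepsArr, trivial⟩, hp⟩, trivial⟩, trivial⟩, trivial⟩

theorem branchCmd_keepsArr {a : ℕ} (h : a < 11) : ∀ {d : ℕ}, (branchCmd d).KeepsArr a
  | 0 => branchStep_keepsArr trivial h
  | _ + 1 => branchStep_keepsArr ⟨assignThree_keepsArr, branchCmd_keepsArr h, assignThree_keepsArr,
      branchCmd_keepsArr h, assignThree_keepsArr, branchCmd_keepsArr h, trivial⟩ h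

theorem run_copyCmd {W b b' : ℕ} {σ : State} (hW : 1 < W) (h : b + 5 ≤ b' ∨ b' + 5 ≤ b) :
    Run W 11 (copyCmd b b') σ fun τ => τ.path b' = σ.path b := by
  refine Run.flat hW ?_
  simp only [Cmd.wp, copyCmd, Cmd.block, Expr.Ok, Expr.eval, true_and, State.reg_setReg,
    State.path]
  simp only [Nat.add_left_cancel_iff, Nat.reduceEqDiff, if_true, if_false,
    show b + 1 ≠ b' by omega, show b + 2 ≠ b' by omega, show b + 3 ≠ b' by omega,
    show b + 4 ≠ b' by omega, show b + 2 ≠ b' + 1 by omega, show b + 3 ≠ b' + 1 by omega,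
    show b + 4 ≠ b' + 1 by omega, show b + 3 ≠ b' + 2 by omega, show b + 4 ≠ b' + 2 by omega,
    show b + 4 ≠ b' + 3 by omega, show b' ≠ b' + 1 by omega, show b' ≠ b' + 2 by omega,
    show b' ≠ b' + 3 by omega, show b' ≠ b' + 4 by omega]

theorem run_assignThree {W b x y z : ℕ} {σ : State} (hW : 1 < W) (hy : y ≠ b) (hz : z ≠ b)
    (hz' : z ≠ b + 1) :
    Run W 7 (assignThree b x y z) σ fun τ =>
      τ.reg b = σ.reg x ∧ τ.reg (b + 1) = σ.reg y ∧ τ.reg (b + 2) = σ.reg z := by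
  refine Run.flat hW ?_
  simp [Cmd.wp, assignThree, Cmd.block, Expr.Ok, Expr.eval, hy, hz, hz']

end RAM

namespace ArcInstance

variable {I : ArcInstance} {W : ℕ} {σ : State}

variable (I) in
/-- Two internally disjoint paths that avoid `X`. -/
structure Pair (X : ℕ → Prop) (A B : PathData) : Prop where
  left : I.Valid A
  right : I.Valid B
  avoids_left : I.Avoids X A
  avoids_right : I.Avoids X B
  disjoint : Disjoint (I.interior A) (I.interior B)

variable (I) in
/-- The program has stored a pair of paths, or it has failed and `N` holds. -/
def PairResult (X : ℕ → Prop) (N : Prop) (τ : State) : Prop :=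
  (τ.reg 20 ≠ 0 ∧ I.Pair X (τ.path 24) (τ.path 13)) ∨ (τ.reg 20 = 0 ∧ N)

theorem mem_interior_path {τ : State} {b v : ℕ} : v ∈ I.interior (τ.path b) ↔
    v ≠ I.t ∧ (v = τ.reg (b + 2) ∨ v = τ.reg (b + 3) ∨ v = τ.reg (b + 4)) := mem_interior

/-- Failure of the first search has to imply `N` by itself. Failure of the second says that every
admissible path meets the candidate, and this is what `p` may use. The conjunct `σ.reg 20 = 0` in
the conclusion records that failure at the end excludes an earlier success, which is needed to chain
several calls. -/
theorem run_branchStep {b T : ℕ} {p : Cmd} {N : Prop} {X : ℕ → Prop} (hσ : I.Loaded σ)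
    (hW : I.n + I.c + I.m + 4 < W) (hX : X = fun v => σ.arr 10 v ≠ 0) (hs : X I.s) (hb : 30 ≤ b)
    (h20 : I.PairResult X True σ)
    (hN : (∀ A, I.Valid A → ¬ I.Avoids
      (fun v => X v ∨ v = σ.reg b ∨ v = σ.reg (b + 1) ∨ v = σ.reg (b + 2)) A) → N)
    (hp : ∀ τ, I.Loaded τ → τ.reg 20 = 0 → τ.arr 10 = σ.arr 10 →
      τ.reg b = σ.reg b → τ.reg (b + 1) = σ.reg (b + 1) → τ.reg (b + 2) = σ.reg (b + 2) →
      I.Avoids (fun v => X v ∨ v = σ.reg b ∨ v = σ.reg (b + 1) ∨ v = σ.reg (b + 2))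
        (τ.path (b + 3)) →
      (∀ B, I.Valid B → I.Avoids X B → ∃ z ∈ I.interior B, z ∈ I.interior (τ.path (b + 3))) →
      Run W T p τ (I.PairResult X N)) :
    Run W (2 * I.searchTime + 100 + T) (branchStep b p) σ
      (I.PairResult X (σ.reg 20 = 0 ∧ N)) := by
  have hW1 : 1 < W := by omega
  refine Run.le (T := 2 + (7 + (I.searchTime + ((2 + (11 + (7 + (I.searchTime +
    ((2 + (T + 15)) + 1))))) + 1)))) ?_ (by omega)
  refine Run.ite hW1 trivial (fun h0 => ?_) fun h0 => ?_
  · have h0 : σ.reg 20 ≠ 0 := h0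
    refine (Run.flat hW1 (p := .skip) (Q := (· = σ)) rfl).mono (by simp only [Cmd.time]; omega) ?_
    rintro _ _ rfl
    obtain h | h := h20
    exacts [.inl h, absurd h.1 h0]
  have h0 : σ.reg 20 = 0 := h0
  refine (run_assignThree hW1 (by omega) (by omega) (by omega)).next
    fun τ1 ⟨h10, h11, h12⟩ hr1 ha1 => ?_
  have hr1' : ∀ r, r < 10 ∨ 13 ≤ r → τ1.reg r = σ.reg r := fun r hr =>
    hr1 r (assignThree_keepsReg hr)
  have hL1 : I.Loaded τ1 := hσ.congr (fun r hr => hr1' r (by omega))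
    fun a _ => ha1 a assignThree_keepsArr
  have a1 : τ1.arr 10 = σ.arr 10 := ha1 10 assignThree_keepsArr
  subst hX
  refine (run_searchCmd hL1 hW (by rwa [a1])).next fun τ2 h2 hr2 ha2 => ?_
  rw [h10, h11, h12, a1] at h2
  have hr2' : ∀ r, r < 7 ∨ 20 ≤ r → τ2.reg r = σ.reg r := fun r hr => by
    rw [hr2 r (searchCmd_keepsReg (by omega) (by omega) (by omega)), hr1' r (by omega)]
  have hL2 : I.Loaded τ2 := hL1.congr
    (fun r hr => hr2 r (searchCmd_keepsReg (by omega) (by omega) (by omega)))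
    fun a ha => ha2 a (searchCmd_keepsArr (by omega))
  have a2 : τ2.arr 10 = σ.arr 10 := (ha2 10 (searchCmd_keepsArr (by omega))).trans a1
  refine Run.block_cons (Run.ite hW1 trivial (fun h13 => ?_) fun h13 => ?_)
  swap
  · have h13 : τ2.reg 13 = 0 := h13
    obtain h2 | h2 := h2
    swap
    · exact absurd h13 h2.1
    refine (Run.flat hW1 (p := .skip) (Q := (· = τ2)) rfl).mono
      (by simp only [Cmd.time]; omega) ?_
    rintro _ _ rfl
    exact Run.block_nil (.inr ⟨by rw [hr2' 20 (by omega), h0], h0, hN fun A hA =>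
      h2.2 A hA trivial⟩)
  have h13 : τ2.reg 13 ≠ 0 := h13
  obtain h2 | ⟨-, hv2, hav2⟩ := h2
  · exact absurd h2.1 h13
  refine (run_copyCmd hW1 (by omega)).next fun τ3 h3 hr3 ha3 => ?_
  have hr3' : ∀ r, r < b + 3 ∨ b + 8 ≤ r → τ3.reg r = τ2.reg r := fun r hr =>
    hr3 r (copyCmd_keepsReg (by omega))
  refine (run_assignThree hW1 (by omega) (by omega) (by omega)).next
    fun τ4 ⟨h410, h411, h412⟩ hr4 ha4 => ?_
  have hr4' : ∀ r, r < 10 ∨ 13 ≤ r → τ4.reg r = τ3.reg r := fun r hr =>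
    hr4 r (assignThree_keepsReg hr)
  have p4 : τ4.path (b + 3) = τ2.path 13 := by
    rw [← h3]
    simp only [State.path, hr4' (b + 3) (by omega), hr4' (b + 3 + 1) (by omega),
      hr4' (b + 3 + 2) (by omega), hr4' (b + 3 + 3) (by omega), hr4' (b + 3 + 4) (by omega)]
  have hL4 : I.Loaded τ4 := hL2.congr
    (fun r hr => by rw [hr4' r (by omega), hr3' r (by omega)])
    fun a ha => by rw [ha4 a assignThree_keepsArr, ha3 a copyCmd_keepsArr]
  have a4 : τ4.arr 10 = σ.arr 10 := by
    rw [ha4 10 assignThree_keepsArr, ha3 10 copyCmd_keepsArr, a2]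
  rw [hr3' 15 (by omega)] at h410
  rw [hr3' 16 (by omega)] at h411
  rw [hr3' 17 (by omega)] at h412
  refine (run_searchCmd hL4 hW (by rwa [a4])).next fun τ5 h5 hr5 ha5 => ?_
  rw [a4, h410, h411, h412] at h5
  have hr5' : ∀ r, r < 7 ∨ 20 ≤ r → τ5.reg r = τ4.reg r := fun r hr =>
    hr5 r (searchCmd_keepsReg (by omega) (by omega) (by omega))
  have hr52 : ∀ r, r < 7 ∨ 20 ≤ r → r < b + 3 ∨ b + 8 ≤ r → τ5.reg r = σ.reg r := fun r hr hr' => by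
    rw [hr5' r hr, hr4' r (by omega), hr3' r hr', hr2' r hr]
  have p5 : τ5.path (b + 3) = τ2.path 13 := by
    rw [← p4]
    simp only [State.path, hr5' (b + 3) (by omega), hr5' (b + 3 + 1) (by omega),
      hr5' (b + 3 + 2) (by omega), hr5' (b + 3 + 3) (by omega), hr5' (b + 3 + 4) (by omega)]
  have hL5 : I.Loaded τ5 := hL4.congr (fun r hr => hr5' r (by omega))
    fun a ha => ha5 a (searchCmd_keepsArr (by omega))
  have a5 : τ5.arr 10 = σ.arr 10 := (ha5 10 (searchCmd_keepsArr (by omega))).trans a4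
  refine Run.block_cons (Run.ite hW1 trivial (fun h135 => ?_) fun h135 => ?_)
  · have h135 : τ5.reg 13 ≠ 0 := h135
    obtain h5 | ⟨-, hv5, hav5⟩ := h5
    · exact absurd h5.1 h135
    refine Run.le (T := (Cmd.assign 20 (.const 1)).time + (11 + 1)) ?_
      (by simp only [Cmd.time, Expr.cost]; omega)
    refine Run.next (Run.flat hW1 (p := .assign 20 (.const 1)) (Q := (· = τ5.setReg 20 1))
      ⟨by simpa only [Expr.Ok] using hW1, rfl⟩) ?_
    rintro _ rfl - -
    refine (run_copyCmd hW1 (by omega)).next fun τ7 h7 hr7 ha7 =>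
      Run.block_nil (Run.block_nil (Run.block_nil (.inl ?_)))
    have hr7' : ∀ r, r < 24 ∨ 29 ≤ r → τ7.reg r = if r = 20 then 1 else τ5.reg r := fun r hr => by
      rw [hr7 r (copyCmd_keepsReg (by omega)), State.reg_setReg]
    have p71 : τ7.path 24 = τ2.path 13 := by
      rw [h7, ← p5]
      simp [State.path, show b + 3 ≠ 20 by omega, show b + 3 + 1 ≠ 20 by omega,
        show b + 3 + 2 ≠ 20 by omega, show b + 3 + 3 ≠ 20 by omega, show b + 3 + 4 ≠ 20 by omega]
    have p72 : τ7.path 13 = τ5.path 13 := by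
      simp [State.path, hr7']
    refine ⟨by simp [hr7'], ?_⟩
    rw [p71, p72]
    refine ⟨hv2, hv5, fun v hv h => hav2 v hv (.inl h), fun v hv h => hav5 v hv (.inl h), ?_⟩
    rw [Finset.disjoint_left]
    exact fun v hv hv' => hav5 v hv' (.inr (mem_interior_path.1 hv).2)
  · have h135 : τ5.reg 13 = 0 := h135
    obtain h5 | h5 := h5
    swap
    · exact absurd h135 h5.1
    refine (hp τ5 hL5 ((hr52 20 (by omega) (by omega)).trans h0) a5
      (hr52 b (by omega) (by omega)) (hr52 _ (by omega) (by omega))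
      (hr52 _ (by omega) (by omega)) (by rwa [p5]) ?_).mono (by omega) fun τ6 _ h6 =>
        Run.block_nil (Run.block_nil ?_)
    · intro B hB hXB
      by_contra! hdis
      rw [p5] at hdis
      refine h5.2 B hB trivial fun v hv => ?_
      rintro (h | h)
      · exact hXB v hv h
      · exact hdis v hv (mem_interior_path.2 ⟨(mem_interior.1 hv).1, h⟩)
    · obtain h6 | h6 := h6
      · exact .inl h6
      · exact .inr ⟨h6.1, h0, h6.2⟩

variable (I) in
/-- If `x`, `y`, `z` start with `3 - d` distinct nodes, then there is no pair whose second path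
contains all of `x`, `y`, `z`. -/
def NoPair (X : ℕ → Prop) (d x y z : ℕ) : Prop :=
  ([x, y, z].take (3 - d)).Nodup → I.t ∉ [x, y, z].take (3 - d) → ∀ A B, I.Pair X A B →
    ¬ ∀ v, v ≠ I.t → v = x ∨ v = y ∨ v = z → v ∈ I.interior B

/-- In a pair whose second path contains the required nodes, the first path avoids them by
disjointness. -/
theorem NoPair.of_forall_not_avoids {X : ℕ → Prop} {d x y z : ℕ}
    (h : ∀ A, I.Valid A → ¬ I.Avoids (fun v => X v ∨ v = x ∨ v = y ∨ v = z) A) :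
    I.NoPair X d x y z := fun _ _ A _ hAB hB => h A hAB.left fun v hv hX =>
  hX.elim (hAB.avoids_left v hv) fun hv' =>
    Finset.disjoint_left.1 hAB.disjoint hv (hB v (mem_interior.1 hv).1 hv')

/-- The second path would contain three distinct required nodes and a node of `A₀`, which is none of
them; but a path has at most three internal nodes. -/
theorem NoPair.zero {X : ℕ → Prop} {x y z : ℕ} {A₀ : PathData}
    (hA₀ : I.Avoids (fun v => X v ∨ v = x ∨ v = y ∨ v = z) A₀)
    (h : ∀ B, I.Valid B → I.Avoids X B → ∃ v ∈ I.interior B, v ∈ I.interior A₀) :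
    I.NoPair X 0 x y z := by
  intro hd ht A B hAB hB
  obtain ⟨v, hv, hv'⟩ := h B hAB.right hAB.avoids_right
  have hv0 := hA₀ v hv'
  simp only [tsub_zero, List.take_succ_cons, List.take_zero, List.nodup_cons, List.mem_cons,
    List.not_mem_nil, or_false, not_or] at hd ht hv0
  have hsub : ({v, x, y, z} : Finset ℕ) ⊆ I.interior B := by
    intro w hw
    simp only [Finset.mem_insert, Finset.mem_singleton] at hw
    obtain rfl | hw := hw
    · exact hv
    · refine hB w ?_ hw
      rintro rfl
      obtain h | h | h := hw
      exacts [ht.1 h, ht.2.1 h, ht.2.2 h]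
  have hcard : ({v, x, y, z} : Finset ℕ).card = 4 := by
    rw [Finset.card_insert_of_notMem (by simp; tauto),
      Finset.card_insert_of_notMem (by simp; tauto),
      Finset.card_insert_of_notMem (by simp; tauto), Finset.card_singleton]
  have := Finset.card_le_card hsub
  have := card_interior_le (I := I) (D := B)
  omega

/-- The second path meets `A₀` in some `v`, which is a new node because `A₀` avoids the required
ones. So `v` can be added to them, and the case is excluded by the branch for `v`. -/
theorem NoPair.succ {X : ℕ → Prop} {d x y z : ℕ} {A₀ : PathData} (hd3 : d < 3)
    (hA₀ : I.Avoids (fun v => X v ∨ v = x ∨ v = y ∨ v = z) A₀)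
    (h : ∀ B, I.Valid B → I.Avoids X B → ∃ v ∈ I.interior B, v ∈ I.interior A₀)
    (h' : ∀ v ∈ I.interior A₀, I.NoPair X d v x y) : I.NoPair X (d + 1) x y z := by
  intro hd ht A B hAB hB
  obtain ⟨v, hv, hv'⟩ := h B hAB.right hAB.avoids_right
  have hv0 := hA₀ v hv'
  have hvt := (mem_interior.1 hv).1
  refine h' v hv' ?_ ?_ A B hAB ?_
  · interval_cases d <;> simp at hd ⊢ <;> tauto
  · interval_cases d <;> simp at ht ⊢ <;> tauto
  · rintro w hw (rfl | rfl | rfl)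
    exacts [hv, hB _ hw (.inl rfl), hB _ hw (.inr (.inl rfl))]

variable (I) in
def branchTime : ℕ → ℕ
  | 0 => 2 * I.searchTime + 101
  | d + 1 => 2 * I.searchTime + 122 + 3 * branchTime d

/-- Induction on the remaining depth, with three recursive calls per level. For `d = 3` this makes
at most 2(1 + 3 + 9 + 27) = 80 path searches. -/
theorem run_branchCmd {X : ℕ → Prop} (hW : I.n + I.c + I.m + 4 < W) (hs : X I.s) :
    ∀ {d : ℕ} {σ : State}, d ≤ 3 → I.Loaded σ → (X = fun v => σ.arr 10 v ≠ 0) →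
      I.PairResult X True σ → Run W (I.branchTime d) (branchCmd d) σ
        (I.PairResult X (σ.reg 20 = 0 ∧ I.NoPair X d (σ.reg (30 + 10 * d))
          (σ.reg (30 + 10 * d + 1)) (σ.reg (30 + 10 * d + 2)))) := by
  have hW1 : 1 < W := by omega
  intro d
  induction d with
  | zero =>
    intro σ _ hσ hX h20
    refine (run_branchStep (T := 1) hσ hW hX hs (by omega) h20 .of_forall_not_avoids ?_).le (by
      simp only [branchTime]; omega)
    intro τ hτ h0 _ _ _ _ hav hB
    exact Run.flat hW1 (.inr ⟨h0, .zero hav hB⟩)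
  | succ d ih =>
    intro σ hd hσ hX h20
    refine (run_branchStep (b := 40 + 10 * d) (T := 7 + (I.branchTime d + (7 + (I.branchTime d +
      (7 + (I.branchTime d + 1)))))) hσ hW hX hs (by omega) h20
      (NoPair.of_forall_not_avoids (d := d + 1)) ?_).mono (by
      simp only [branchTime]; omega) fun τ _ h => ?_
    swap
    · rwa [show 30 + 10 * (d + 1) = 40 + 10 * d by omega]
    intro τ hτ h0 ha hb0 hb1 hb2 hav hB
    -- The three recursive calls treated uniformly; `N` collects what the preceding failed calls
    -- have excluded.
    have child : ∀ (r T : ℕ) (l : List Cmd) (υ : State) (N : Prop) (Q : State → Prop),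
        43 + 10 * d ≤ r → I.Loaded υ →
        υ.arr 10 = σ.arr 10 → (∀ r, 40 + 10 * d ≤ r → υ.reg r = τ.reg r) → I.PairResult X N υ →
        (∀ φ, I.Loaded φ → φ.arr 10 = σ.arr 10 → (∀ r, 40 + 10 * d ≤ r → φ.reg r = τ.reg r) →
          I.PairResult X (N ∧ I.NoPair X d (τ.reg r) (σ.reg (40 + 10 * d))
            (σ.reg (40 + 10 * d + 1))) φ → Run W T (.block l) φ Q) →
        Run W (7 + (I.branchTime d + T)) (.block (assignThree (30 + 10 * d) r (40 + 10 * d)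
          (41 + 10 * d) :: branchCmd d :: l)) υ Q := by
      intro r T l υ N Q hr hυ haυ hrυ hN hQ
      refine (run_assignThree hW1 (by omega) (by omega) (by omega)).next
        fun φ ⟨h1, h2, h3⟩ hrφ haφ => ?_
      have hrφ' : ∀ r, r < 30 + 10 * d ∨ 33 + 10 * d ≤ r → φ.reg r = υ.reg r := fun r hr =>
        hrφ r (assignThree_keepsReg (by omega))
      have hφ : I.Loaded φ := hυ.congr (fun r hr => hrφ' r (by omega))
        fun a _ => haφ a assignThree_keepsArr
      have haφ' : φ.arr 10 = σ.arr 10 := (haφ 10 assignThree_keepsArr).trans haυ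
      have hpath : φ.path 24 = υ.path 24 ∧ φ.path 13 = υ.path 13 := by
        constructor <;> simp only [State.path] <;> congr 1 <;> exact hrφ' _ (by omega)
      have h20' : φ.reg 20 = υ.reg 20 := hrφ' 20 (by omega)
      refine (ih (by omega) hφ (by rw [haφ', hX]) ?_).next fun ψ hψ hrψ haψ => ?_
      · rw [PairResult, hpath.1, hpath.2, h20']
        exact hN.imp id fun h => ⟨h.1, trivial⟩
      · refine hQ ψ (hφ.congr (fun r hr => hrψ r (branchCmd_keepsReg (by omega)))
          fun a ha => haψ a (branchCmd_keepsArr (by omega)))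
          ((haψ 10 (branchCmd_keepsArr (by omega))).trans haφ')
          (fun r hr => by
            rw [hrψ r (branchCmd_keepsReg (by omega)), hrφ' r (by omega), hrυ r hr]) ?_
        refine hψ.imp id ?_
        rintro ⟨h4, h5, h6⟩
        rw [h1, h2, h3, hrυ r (by omega), hrυ (40 + 10 * d) (by omega),
          hrυ (41 + 10 * d) (by omega), hb0, show 41 + 10 * d = 40 + 10 * d + 1 by omega, hb1] at h6
        rw [h20'] at h5
        refine ⟨h4, ?_, h6⟩
        -- Register 20 was still 0 before the call, so the earlier calls had failed too.
        obtain hN | hN := hN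
        exacts [absurd h5 hN.1, hN.2]
    refine child _ _ _ τ True _ (by omega) hτ ha (fun _ _ => rfl) (.inr ⟨h0, trivial⟩)
      fun τ1 hτ1 ha1 hr1 h1 => ?_
    refine child _ _ _ τ1 _ _ (by omega) hτ1 ha1 hr1 h1 fun τ2 hτ2 ha2 hr2 h2 => ?_
    refine child _ _ _ τ2 _ _ (by omega) hτ2 ha2 hr2 h2 fun τ3 hτ3 ha3 hr3 h3 => ?_
    refine Run.block_nil (h3.imp id fun h => ⟨h.1, ?_⟩)
    obtain ⟨-, ⟨⟨-, n1⟩, n2⟩, n3⟩ := h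
    refine .succ (by omega) hav hB fun v hv => ?_
    obtain ⟨-, rfl | rfl | rfl⟩ := mem_interior_path.1 hv
    · rwa [show 40 + 10 * d + 3 + 2 = 45 + 10 * d by omega]
    · rwa [show 40 + 10 * d + 3 + 3 = 46 + 10 * d by omega]
    · rwa [show 40 + 10 * d + 3 + 4 = 47 + 10 * d by omega]

end ArcInstance

/-! ### The local search

Register `5` contains the number of paths, and register `6` the index of the path whose replacement
is tried. -/

namespace RAM

/-- Marks `s` and the nodes of all stored paths except the one with the index in register 6. The
padding causes `t` to be marked as well, which `blockedCmd` undoes. -/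
def markCmd : Cmd := .block
  [.forTo 7 0 (.write 10 (.reg 7) (.const 0)), .write 10 (.reg 3) (.const 1),
    .forTo 7 5 (.ite (.op .eq (.reg 7) (.reg 6)) .skip (.block
      [.write 10 (.read 6 (.reg 7)) (.const 1), .write 10 (.read 7 (.reg 7)) (.const 1),
        .write 10 (.read 8 (.reg 7)) (.const 1)]))]

/-- Store the path from the registers `b, …, b + 4` at the index in register `q`. -/
def storeCmd (q b : ℕ) : Cmd := .block
  [.write 4 (.reg q) (.reg b), .write 3 (.reg q) (.reg (b + 1)), .write 5 (.reg q) (.reg 3),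
    .write 6 (.reg q) (.reg (b + 2)), .write 7 (.reg q) (.reg (b + 3)),
    .write 8 (.reg q) (.reg (b + 4)), .write 9 (.reg q) (.reg 4)]

/-- Swaps need a member to replace, so a first path is found by a plain search; `t` in registers 10,
11, 12 means that nothing further is forbidden. -/
def startCmd : Cmd := .block
  [markCmd, assignThree 10 4 4 4, searchCmd,
    .ite (.reg 13) (.block [storeCmd 5 13, .assign 5 (.const 1)]) .skip]

/-- Registers 60, 61, 62 are the required nodes of level 3, all padding. After an improvement the
earlier failed tests concern an outdated family, so the index returns to 0. -/
def swapCmd : Cmd := .block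
  [markCmd, .assign 20 (.const 0), assignThree 60 4 4 4, branchCmd 3,
    .ite (.reg 20) (.block
      [storeCmd 6 24, storeCmd 5 13, .assign 5 (.op .add (.reg 5) (.const 1)),
        .assign 6 (.const 0)])
      (.assign 6 (.op .add (.reg 6) (.const 1)))]

/-- The path that is stored at index `k` of the output arrays. -/
def State.slot (σ : State) (k : ℕ) : PathData :=
  ⟨σ.arr 4 k, σ.arr 3 k, σ.arr 6 k, σ.arr 7 k, σ.arr 8 k⟩

theorem markCmd_keepsReg {r : ℕ} (h : r ≠ 7) : markCmd.KeepsReg r := by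
  simp [markCmd, Cmd.KeepsReg, Cmd.block, h]

theorem markCmd_keepsArr {a : ℕ} (h : a ≠ 10) : markCmd.KeepsArr a := by
  simp [markCmd, Cmd.KeepsArr, Cmd.block, h]

theorem storeCmd_keepsReg {q b r : ℕ} : (storeCmd q b).KeepsReg r := by
  simp [storeCmd, Cmd.KeepsReg, Cmd.block]

theorem storeCmd_keepsArr {q b a : ℕ} (h : a < 3 ∨ 10 ≤ a) : (storeCmd q b).KeepsArr a := by
  simp only [storeCmd, Cmd.KeepsArr, Cmd.block, and_true]
  omega

theorem run_storeCmd {W q b : ℕ} {σ : State} (hW : 1 < W) :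
    Run W 22 (storeCmd q b) σ fun τ =>
      τ.slot (σ.reg q) = σ.path b ∧ τ.arr 5 (σ.reg q) = σ.reg 3 ∧ τ.arr 9 (σ.reg q) = σ.reg 4 ∧
      ∀ k ≠ σ.reg q, τ.slot k = σ.slot k ∧ τ.arr 5 k = σ.arr 5 k ∧ τ.arr 9 k = σ.arr 9 k := by
  refine Run.flat hW ?_
  simp +contextual [Cmd.wp, storeCmd, Cmd.block, Expr.Ok, Expr.eval, State.slot, State.path]

end RAM

/-! ### Correctness and running time of a swap -/

namespace ArcInstance

variable {I : ArcInstance} {W : ℕ} {σ : State}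

variable (I) in
/-- The nodes that are forbidden if the path with index `r` is removed from the family. -/
def Used (σ : State) (r v : ℕ) : Prop :=
  v = I.s ∨ ∃ k < σ.reg 5, k ≠ r ∧ v ∈ I.interior (σ.slot k)

theorem mem_interior_slot {τ : State} {k v : ℕ} : v ∈ I.interior (τ.slot k) ↔
    v ≠ I.t ∧ (v = τ.arr 6 k ∨ v = τ.arr 7 k ∨ v = τ.arr 8 k) := mem_interior

theorem run_markCmd (hσ : I.Loaded σ) (hW : I.n + I.c + I.m + 4 < W) :
    Run W (I.n * 100 + σ.reg 5 * 100 + 50) markCmd σ fun τ =>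
      ∀ v < I.n, v ≠ I.t → (τ.arr 10 v ≠ 0 ↔ I.Used σ (σ.reg 6) v) := by
  have hW1 : 1 < W := by omega
  refine Run.le (T := (I.n * (3 + 8) + 6) + (3 + ((σ.reg 5 * (18 + 8) + 6) + 1))) ?_ (by omega)
  have h1 := Run.forTo (σ := σ) (i := 7) (N := 0) (T := 3) (W := W)
    (p := .write 10 (.reg 7) (.const 0)) (fun k τ => ∀ v < k, τ.arr 10 v = 0) hW1
    (by omega) (by simp [Cmd.KeepsReg]) (by simp [Cmd.KeepsReg]) (by simp) (by
      intro k τ hk hk7 hr ha hI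
      refine Run.flat hW1 ?_
      simp only [Cmd.wp, Expr.Ok, Expr.eval, true_and, hk7, show 0 < W by omega]
      intro v hv
      by_cases hvk : v = k
      · subst hvk
        simp
      · simpa [hvk] using hI v (by omega))
  rw [hσ.n] at h1
  refine h1.next fun τ1 h1 hr1 ha1 => ?_
  have er : ∀ r, r ≠ 7 → τ1.reg r = σ.reg r := fun r hr => hr1 r (by simp [Cmd.KeepsReg, hr])
  have ea : ∀ a, a ≠ 10 → τ1.arr a = σ.arr a := fun a ha => ha1 a (by simp [Cmd.KeepsArr, ha])
  refine Run.next (p := .write 10 (.reg 3) (.const 1)) (Q := fun τ => τ = τ1.setArr 10 I.s 1)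
    (Run.flat hW1 ?_) ?_
  · simp [Cmd.wp, Expr.Ok, Expr.eval, er 3, hσ.s, hW1]
  rintro _ rfl - -
  set τ2 := τ1.setArr 10 I.s 1 with hτ2
  have h2 := Run.forTo (σ := τ2) (i := 7) (N := 5) (T := 18) (W := W)
    (p := .ite (.op .eq (.reg 7) (.reg 6)) .skip (.block
      [.write 10 (.read 6 (.reg 7)) (.const 1), .write 10 (.read 7 (.reg 7)) (.const 1),
        .write 10 (.read 8 (.reg 7)) (.const 1)]))
    (fun k τ => ∀ v < I.n, v ≠ I.t → (τ.arr 10 v ≠ 0 ↔ v = I.s ∨ ∃ k' < k, k' ≠ σ.reg 6 ∧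
      v ∈ I.interior (σ.slot k'))) hW1
    (by omega) (by simp [Cmd.KeepsReg, Cmd.block]) (by simp [Cmd.KeepsReg, Cmd.block]) ?_ ?_
  · rw [show τ2.reg 5 = σ.reg 5 from er 5 (by omega)] at h2
    exact h2.next fun τ3 h3 _ _ => Run.block_nil h3
  · intro v hv hvt
    by_cases hvs : v = I.s
    · simp [hτ2, hvs]
    · simp [hτ2, hvs, h1 v hv]
  · intro k τ hk hk7 hr ha hI
    have e6 : τ.reg 6 = σ.reg 6 :=
      (hr 6 (by omega) (by simp [Cmd.KeepsReg, Cmd.block])).trans (er 6 (by omega))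
    have ea' : ∀ a, a ≠ 10 → τ.arr a = σ.arr a := fun a ha10 => by
      rw [ha a (by simp [Cmd.KeepsArr, Cmd.block, ha10]), ← ea a ha10]
      simp [hτ2, ha10]
    refine Run.flat hW1 ?_
    simp only [Cmd.wp, Cmd.block, Expr.Ok, Expr.eval, BinOp.eval, true_and, hk7, e6, hW1,
      State.arr_setReg, State.reg_setArr]
    refine ⟨fun hkr v hv hvt => ?_, fun hkr v hv hvt => ?_⟩
    · have hkr : k = σ.reg 6 := by simpa using hkr
      rw [hI v hv hvt]
      refine or_congr_right (exists_congr fun k' => ?_)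
      constructor
      · exact fun h => ⟨by omega, h.2⟩
      · exact fun h => ⟨by have := h.2.1; omega, h.2⟩
    · have hkr : k ≠ σ.reg 6 := by simpa using hkr
      have : (∃ k' < k + 1, k' ≠ σ.reg 6 ∧ v ∈ I.interior (σ.slot k')) ↔
          (∃ k' < k, k' ≠ σ.reg 6 ∧ v ∈ I.interior (σ.slot k')) ∨
            v = σ.arr 6 k ∨ v = σ.arr 7 k ∨ v = σ.arr 8 k := by
        simp only [Nat.lt_succ_iff_lt_or_eq, or_and_right, exists_or, exists_eq_left,
          mem_interior_slot, hkr, hvt, ne_eq, not_false_eq_true, true_and]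
      rw [this, ← or_assoc, ← hI v hv hvt]
      have h6 := ea' 6 (by omega)
      have h7 := ea' 7 (by omega)
      have h8 := ea' 8 (by omega)
      simp only [State.arr_setArr, if_true, Function.update_apply, h6, h7, h8,
        Nat.reduceEqDiff, if_false]
      split_ifs <;> simp_all

variable (I) in
/-- The memory contains a family of internally disjoint paths. -/
structure Family (σ : State) : Prop where
  valid : ∀ k < σ.reg 5, I.Valid (σ.slot k)
  first : ∀ k < σ.reg 5, σ.arr 5 k = I.s
  last : ∀ k < σ.reg 5, σ.arr 9 k = I.t
  disjoint : ∀ k < σ.reg 5, ∀ k' < σ.reg 5, k ≠ k' →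
    Disjoint (I.interior (σ.slot k)) (I.interior (σ.slot k'))

/-- The first internal nodes of the paths are distinct. This bounds the marking time, the number of
improvements and the word size. -/
theorem Family.card_le (h : I.Family σ) : σ.reg 5 ≤ I.n := by
  have := Finset.card_le_card_of_injOn (s := Finset.range (σ.reg 5)) (t := Finset.range I.n)
    (fun k => (σ.slot k).x) (fun k hk => by
      simpa using (h.valid k (by simpa using hk)).lt.1) (fun k hk k' hk' hkk => by
      by_contra hne
      simp only [Finset.coe_range, Set.mem_Iio] at hk hk'
      have h1 := (h.valid k hk).x_mem_interior
      have h2 := (h.valid k' hk').x_mem_interior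
      simp only at hkk
      rw [hkk] at h1
      exact Finset.disjoint_left.1 (h.disjoint k hk k' hk' hne) h1 h2)
  simpa using this

theorem Avoids.congr {X Y : ℕ → Prop} {D : PathData} (hD : I.Valid D)
    (h : ∀ v < I.n, v ≠ I.t → (X v ↔ Y v)) (hX : I.Avoids X D) : I.Avoids Y D :=
  fun v hv hY => hX v hv ((h v (hD.lt_of_mem hv) (mem_interior.1 hv).1).2 hY)

theorem Pair.congr {X Y : ℕ → Prop} {A B : PathData} (h : ∀ v < I.n, v ≠ I.t → (X v ↔ Y v))
    (hX : I.Pair X A B) : I.Pair Y A B :=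
  ⟨hX.left, hX.right, hX.avoids_left.congr hX.left h, hX.avoids_right.congr hX.right h, hX.disjoint⟩

variable (I) in
/-- The family cannot be improved by replacing one of the first `r` paths by two paths. -/
structure SearchInv (σ : State) : Prop where
  loaded : I.Loaded σ
  family : I.Family σ
  le : σ.reg 6 ≤ σ.reg 5
  opt : ∀ r < σ.reg 6, ∀ A B, ¬ I.Pair (I.Used σ r) A B
  nonempty : σ.reg 5 = 0 → ∀ D, ¬ I.Valid D

theorem Family.add {τ : State} (hσ : I.Family σ) (h5 : τ.reg 5 = σ.reg 5 + 1)
    (hold : ∀ k < σ.reg 5, τ.slot k = σ.slot k ∧ τ.arr 5 k = σ.arr 5 k ∧ τ.arr 9 k = σ.arr 9 k)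
    (hnew : I.Valid (τ.slot (σ.reg 5))) (hs : τ.arr 5 (σ.reg 5) = I.s)
    (ht : τ.arr 9 (σ.reg 5) = I.t)
    (hd : ∀ k < σ.reg 5, Disjoint (I.interior (σ.slot k)) (I.interior (τ.slot (σ.reg 5)))) :
    I.Family τ := by
  have hlt : ∀ {k}, k < τ.reg 5 → k < σ.reg 5 ∨ k = σ.reg 5 := fun h => by omega
  refine ⟨fun k hk => ?_, fun k hk => ?_, fun k hk => ?_, fun k hk k' hk' hne => ?_⟩
  · obtain hk | rfl := hlt hk
    exacts [(hold k hk).1 ▸ hσ.valid k hk, hnew]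
  · obtain hk | rfl := hlt hk
    exacts [(hold k hk).2.1.trans (hσ.first k hk), hs]
  · obtain hk | rfl := hlt hk
    exacts [(hold k hk).2.2.trans (hσ.last k hk), ht]
  · obtain hk | rfl := hlt hk <;> obtain hk' | rfl := hlt hk'
    · rw [(hold k hk).1, (hold k' hk').1]
      exact hσ.disjoint k hk k' hk' hne
    · rw [(hold k hk).1]
      exact hd k hk
    · rw [(hold k' hk').1]
      exact (hd k' hk').symm
    · exact absurd rfl hne

theorem Family.replace {τ : State} {r : ℕ} (hσ : I.Family σ) (h5 : τ.reg 5 = σ.reg 5)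
    (hold : ∀ k ≠ r, τ.slot k = σ.slot k ∧ τ.arr 5 k = σ.arr 5 k ∧ τ.arr 9 k = σ.arr 9 k)
    (hnew : I.Valid (τ.slot r)) (hs : τ.arr 5 r = I.s) (ht : τ.arr 9 r = I.t)
    (hd : ∀ k < σ.reg 5, k ≠ r → Disjoint (I.interior (σ.slot k)) (I.interior (τ.slot r))) :
    I.Family τ := by
  refine ⟨fun k hk => ?_, fun k hk => ?_, fun k hk => ?_, fun k hk k' hk' hne => ?_⟩
  · by_cases hr : k = r
    exacts [hr ▸ hnew, (hold k hr).1 ▸ hσ.valid k (h5 ▸ hk)]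
  · by_cases hr : k = r
    exacts [hr ▸ hs, (hold k hr).2.1.trans (hσ.first k (h5 ▸ hk))]
  · by_cases hr : k = r
    exacts [hr ▸ ht, (hold k hr).2.2.trans (hσ.last k (h5 ▸ hk))]
  · rw [h5] at hk hk'
    by_cases hr : k = r
    · subst hr
      rw [(hold k' (Ne.symm hne)).1]
      exact (hd k' hk' (Ne.symm hne)).symm
    · rw [(hold k hr).1]
      by_cases hr' : k' = r
      · subst hr'
        exact hd k hk hne
      · rw [(hold k' hr').1]
        exact hσ.disjoint k hk k' hk' hne

theorem Avoids.disjoint_slot {r k : ℕ} {D : PathData} (h : I.Avoids (I.Used σ r) D)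
    (hk : k < σ.reg 5) (hr : k ≠ r) : Disjoint (I.interior (σ.slot k)) (I.interior D) :=
  Finset.disjoint_left.2 fun v hv hv' => h v hv' (.inr ⟨k, hk, hr, hv⟩)

variable (I) in
def swapTime : ℕ := I.branchTime 3 + I.n * 200 + 200

theorem run_swapCmd (hW : I.n + I.c + I.m + 4 < W) (hσ : I.SearchInv σ)
    (hlt : σ.reg 6 < σ.reg 5) :
    Run W I.swapTime swapCmd σ fun τ => I.SearchInv τ ∧
      ((τ.reg 5 = σ.reg 5 + 1 ∧ τ.reg 6 = 0) ∨ (τ.reg 5 = σ.reg 5 ∧ τ.reg 6 = σ.reg 6 + 1)) := by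
  have hW1 : 1 < W := by omega
  have hcard := hσ.family.card_le
  refine Run.le (T := (I.n * 100 + σ.reg 5 * 100 + 50) + (2 + (7 + (I.branchTime 3 +
    (2 + (22 + (22 + 7)) + 1))))) ?_ (by simp only [swapTime]; omega)
  refine (run_markCmd hσ.loaded hW).next fun τ1 h1 hr1 ha1 => ?_
  have hL1 : I.Loaded τ1 := hσ.loaded.congr (fun r hr => hr1 r (markCmd_keepsReg (by omega)))
    fun a ha => ha1 a (markCmd_keepsArr (by omega))
  refine Run.next (p := .assign 20 (.const 0)) (Q := fun τ => τ = τ1.setReg 20 0)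
    (Run.flat hW1 ⟨show 0 < W by omega, rfl⟩) ?_
  rintro _ rfl - -
  refine (run_assignThree hW1 (by omega) (by omega) (by omega)).next
    fun τ3 ⟨h60, h61, h62⟩ hr3 ha3 => ?_
  have er3 : ∀ r, r < 60 ∨ 63 ≤ r → τ3.reg r = if r = 20 then 0 else τ1.reg r := fun r hr => by
    rw [hr3 r (assignThree_keepsReg (by omega)), State.reg_setReg]
  have ea3 : ∀ a, τ3.arr a = τ1.arr a := fun a => by
    rw [ha3 a assignThree_keepsArr, State.arr_setReg]
  have hL3 : I.Loaded τ3 := hL1.congr (fun r hr => by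
    rw [er3 r (by omega), if_neg (by omega)]) fun a ha => ea3 a
  have hX : ∀ v < I.n, v ≠ I.t → (τ3.arr 10 v ≠ 0 ↔ I.Used σ (σ.reg 6) v) := by
    rwa [ea3]
  refine (run_branchCmd hW (X := fun v => τ3.arr 10 v ≠ 0)
    ((hX _ I.s_lt I.s_ne_t).2 (.inl rfl)) le_rfl hL3 rfl (.inr ⟨?_, trivial⟩)).next
    fun τ4 h4 hr4 ha4 => ?_
  · rw [er3 20 (by omega), if_pos rfl]
  have er4 : ∀ r < 7, τ4.reg r = σ.reg r := fun r hr => by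
    rw [hr4 r (branchCmd_keepsReg (by omega)), er3 r (by omega), if_neg (by omega),
      hr1 r (markCmd_keepsReg (by omega))]
  have ea4 : ∀ a < 10, τ4.arr a = σ.arr a := fun a ha => by
    rw [ha4 a (branchCmd_keepsArr (by omega)), ea3, ha1 a (markCmd_keepsArr (by omega))]
  have es4 : ∀ k, τ4.slot k = σ.slot k := fun k => by
    simp only [State.slot, ea4 3 (by omega), ea4 4 (by omega), ea4 6 (by omega),
      ea4 7 (by omega), ea4 8 (by omega)]
  have hL4 : I.Loaded τ4 := hσ.loaded.congr (fun r hr => er4 r (by omega))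
    fun a ha => ea4 a (by omega)
  have hF4 : I.Family τ4 := by
    refine ⟨?_, ?_, ?_, ?_⟩
    · simpa only [er4 5 (by omega), es4] using hσ.family.valid
    · simpa only [er4 5 (by omega), ea4 5 (by omega)] using hσ.family.first
    · simpa only [er4 5 (by omega), ea4 9 (by omega)] using hσ.family.last
    · simpa only [er4 5 (by omega), es4] using hσ.family.disjoint
  have hU : I.Used τ4 = I.Used σ := by
    ext r v
    simp only [Used, es4, er4 5 (by omega)]
  have e5 := er4 5 (by omega)
  have e6 := er4 6 (by omega)
  refine Run.block_cons (Run.ite hW1 trivial (fun h0 => ?_) fun h0 => ?_)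
  · have h0 : τ4.reg 20 ≠ 0 := h0
    obtain ⟨-, hP⟩ | h4 := h4
    swap
    · exact absurd h4.1 h0
    have hP : I.Pair (I.Used σ (σ.reg 6)) (τ4.path 24) (τ4.path 13) := hP.congr hX
    refine (run_storeCmd hW1).next fun τ5 ⟨h51, h52, h53, h54⟩ hr5 ha5 => ?_
    have er5 : τ5.reg = τ4.reg := funext fun r => hr5 r storeCmd_keepsReg
    rw [e6] at h51 h52 h53 h54
    have hF5 : I.Family τ5 := by
      refine hF4.replace (congrFun er5 5) h54 (h51 ▸ hP.left) (h52.trans hL4.s) (h53.trans hL4.t)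
        fun k hk hkr => ?_
      rw [h51, es4]
      exact hP.avoids_left.disjoint_slot (e5 ▸ hk) hkr
    refine (run_storeCmd hW1).next fun τ6 ⟨h61, h62, h63, h64⟩ hr6 ha6 => ?_
    have er6 : τ6.reg = τ4.reg := funext fun r => (hr6 r storeCmd_keepsReg).trans (congrFun er5 r)
    have ep5 : τ5.path 13 = τ4.path 13 := by simp only [State.path, er5]
    rw [ep5] at h61
    refine (Run.flat hW1 (p := .block [.assign 5 (.op .add (.reg 5) (.const 1)),
      .assign 6 (.const 0)]) (Q := fun τ => τ = (τ6.setReg 5 (σ.reg 5 + 1)).setReg 6 0) ?_).mono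
        (by simp [Cmd.time, Cmd.block, Expr.cost]) fun τ _ hτ => Run.block_nil ?_
    · simp only [Cmd.wp, Cmd.block, Expr.Ok, Expr.eval, BinOp.eval, er6, e5, true_and, and_true]
      omega
    · subst hτ
      set τ := (τ6.setReg 5 (σ.reg 5 + 1)).setReg 6 0 with hτ
      have hLτ : I.Loaded τ := hL4.congr (fun r hr => by
        simp [hτ, show r ≠ 5 by omega, show r ≠ 6 by omega, er6]) fun a ha => by
        simp [hτ, ha6 a (storeCmd_keepsArr (by omega)), ha5 a (storeCmd_keepsArr (by omega))]
      have e55 : τ5.reg 5 = σ.reg 5 := (congrFun er5 5).trans e5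
      rw [e55] at h61 h62 h63 h64
      have hsl : ∀ k, τ.slot k = τ6.slot k := fun k => rfl
      have hFτ : I.Family τ := by
        refine hF5.add (by simp [hτ, e55]) (fun k hk => h64 k (by omega)) ?_ ?_ ?_ fun k hk => ?_
        · rw [e55, hsl, h61]
          exact hP.right
        · rw [e55]
          exact h62.trans (by rw [er5, hL4.s])
        · rw [e55]
          exact h63.trans (by rw [er5, hL4.t])
        · rw [e55, hsl, h61]
          by_cases hk6 : k = σ.reg 6
          · subst hk6
            rw [h51]
            exact hP.disjoint
          · rw [(h54 k hk6).1, es4]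
            exact hP.avoids_right.disjoint_slot (e55 ▸ hk) hk6
      refine ⟨⟨hLτ, hFτ, by simp [hτ], by simp [hτ], by simp [hτ]⟩,
        .inl ⟨by simp [hτ], by simp [hτ]⟩⟩
  · have h0 : τ4.reg 20 = 0 := h0
    obtain h4 | ⟨-, -, h4⟩ := h4
    · exact absurd h0 h4.1
    refine (Run.flat hW1 (p := .assign 6 (.op .add (.reg 6) (.const 1)))
      (Q := fun τ => τ = τ4.setReg 6 (σ.reg 6 + 1)) ?_).mono
        (by simp [Cmd.time, Expr.cost]) fun τ _ hτ => Run.block_nil ?_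
    · simp only [Cmd.wp, Expr.Ok, Expr.eval, BinOp.eval, e6, true_and, and_true]
      omega
    · subst hτ
      have e5' : (τ4.setReg 6 (σ.reg 6 + 1)).reg 5 = τ4.reg 5 := by simp
      have hU' : I.Used (τ4.setReg 6 (σ.reg 6 + 1)) = I.Used σ := by
        rw [← hU]
        ext r v
        simp only [Used, e5']
        rfl
      refine ⟨⟨hL4.congr (fun r hr => by simp [show r ≠ 6 by omega]) fun _ _ => rfl,
        ?_, ?_, ?_, ?_⟩, .inr ⟨by simpa using e5, by simp⟩⟩
      · exact ⟨by rw [e5']; exact hF4.valid, by rw [e5']; exact hF4.first,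
          by rw [e5']; exact hF4.last, by rw [e5']; exact hF4.disjoint⟩
      · simp only [State.reg_setReg]
        simp only [Nat.reduceEqDiff, if_true, if_false]
        omega
      · intro r hr A B hAB
        rw [hU'] at hAB
        have hr : r < σ.reg 6 + 1 := by simpa using hr
        obtain hr | rfl := Nat.lt_succ_iff_lt_or_eq.1 hr
        · exact hσ.opt r hr A B hAB
        · have h60' : τ3.reg (30 + 10 * 3) = I.t := by
            rw [show 30 + 10 * 3 = 60 from rfl, h60]
            simp [hL1.t]
          -- At level 3 no node is genuinely required, so `NoPair` excludes every pair.
          refine h4 (by simp) (by simp) A B (hAB.congr fun v hv hvt => (hX v hv hvt).symm) ?_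
          intro v hvt hv
          rw [show 30 + 10 * 3 = 60 from rfl, h60, h61, h62] at hv
          simp [hL1.t] at hv
          exact absurd hv hvt
      · intro h
        rw [e5', e5] at h
        omega

end ArcInstance

/-! ### Paths of length one and the whole program -/

namespace RAM

/-- Append the path of length one whose colour is that of the list entry with index in
register `7`. -/
def appendEdgeCmd : Cmd := .block
  [.write 3 (.reg 5) (.read 2 (.reg 7)), .write 4 (.reg 5) (.const 1), .write 5 (.reg 5) (.reg 3),
    .write 6 (.reg 5) (.reg 4), .assign 5 (.op .add (.reg 5) (.const 1))]

def directBody : Cmd :=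
  .ite (.op .eq (.read 0 (.reg 7)) (.reg 3))
    (.ite (.op .eq (.read 1 (.reg 7)) (.reg 4)) appendEdgeCmd .skip)
    (.ite (.op .eq (.read 1 (.reg 7)) (.reg 3))
      (.ite (.op .eq (.read 0 (.reg 7)) (.reg 4)) appendEdgeCmd .skip) .skip)

def directCmd : Cmd := .forTo 7 2 directBody

def mainCmd : Cmd := .block
  [startCmd, .loop (.op .lt (.reg 6) (.reg 5)) swapCmd, directCmd]

end RAM

namespace ArcInstance

variable {I : ArcInstance} {W : ℕ} {σ : State}

theorem run_startCmd (hσ : I.Loaded σ) (hW : I.n + I.c + I.m + 4 < W) (h5 : σ.reg 5 = 0)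
    (h6 : σ.reg 6 = 0) :
    Run W (I.n * 100 + I.searchTime + 200) startCmd σ I.SearchInv := by
  have hW1 : 1 < W := by omega
  refine Run.le (T := (I.n * 100 + σ.reg 5 * 100 + 50) + (7 + (I.searchTime +
    (2 + (22 + 3) + 1)))) ?_ (by omega)
  refine (run_markCmd hσ hW).next fun τ1 h1 hr1 ha1 => ?_
  have hL1 : I.Loaded τ1 := hσ.congr (fun r hr => hr1 r (markCmd_keepsReg (by omega)))
    fun a ha => ha1 a (markCmd_keepsArr (by omega))
  refine (run_assignThree hW1 (by omega) (by omega) (by omega)).next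
    fun τ2 ⟨h10, h11, h12⟩ hr2 ha2 => ?_
  have hL2 : I.Loaded τ2 := hL1.congr (fun r hr => hr2 r (assignThree_keepsReg (by omega)))
    fun a _ => ha2 a assignThree_keepsArr
  have a2 : τ2.arr 10 = τ1.arr 10 := ha2 10 assignThree_keepsArr
  refine (run_searchCmd hL2 hW (by rw [a2]; exact (h1 _ I.s_lt I.s_ne_t).2 (.inl rfl))).next
    fun τ3 h3 hr3 ha3 => ?_
  rw [h10, h11, h12, hL1.t, a2] at h3
  have hL3 : I.Loaded τ3 := hL2.congr
    (fun r hr => hr3 r (searchCmd_keepsReg (by omega) (by omega) (by omega)))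
    fun a ha => ha3 a (searchCmd_keepsArr (by omega))
  have er3 : ∀ r < 7, τ3.reg r = σ.reg r := fun r hr => by
    rw [hr3 r (searchCmd_keepsReg (by omega) (by omega) (by omega)),
      hr2 r (assignThree_keepsReg (by omega)), hr1 r (markCmd_keepsReg (by omega))]
  have e5 : τ3.reg 5 = 0 := (er3 5 (by omega)).trans h5
  have e6 : τ3.reg 6 = 0 := (er3 6 (by omega)).trans h6
  refine Run.block_cons (Run.ite hW1 trivial (fun h0 => ?_) fun h0 => ?_)
  · have h0 : τ3.reg 13 ≠ 0 := h0
    obtain h3 | ⟨-, hv, -⟩ := h3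
    · exact absurd h3.1 h0
    refine (run_storeCmd hW1).next fun τ4 ⟨h41, h42, h43, h44⟩ hr4 ha4 => ?_
    have er4 : τ4.reg = τ3.reg := funext fun r => hr4 r storeCmd_keepsReg
    rw [e5] at h41 h42 h43
    refine (Run.flat hW1 (p := .block [.assign 5 (.const 1)])
      (Q := fun τ => τ = τ4.setReg 5 1) ⟨hW1, rfl⟩).mono
      (by simp [Cmd.time, Cmd.block, Expr.cost]) fun τ _ hτ => Run.block_nil ?_
    subst hτ
    have hL4 : I.Loaded (τ4.setReg 5 1) := hL3.congr
      (fun r hr => by simp [show r ≠ 5 by omega, er4])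
      fun a ha => by simp [ha4 a (storeCmd_keepsArr (by omega))]
    have e0 : ∀ k, k < (τ4.setReg 5 1).reg 5 → k = 0 := fun k hk => by simpa using hk
    refine ⟨hL4, ⟨fun k hk => ?_, fun k hk => ?_, fun k hk => ?_, fun k hk k' hk' hne => ?_⟩, ?_,
      ?_, by simp⟩
    · obtain rfl := e0 k hk
      exact h41 ▸ hv
    · obtain rfl := e0 k hk
      exact h42.trans hL3.s
    · obtain rfl := e0 k hk
      exact h43.trans hL3.t
    · exact absurd ((e0 k hk).trans (e0 k' hk').symm) hne
    · simp [er4, e6]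
    · simp [er4, e6]
  · have h0 : τ3.reg 13 = 0 := h0
    obtain ⟨-, h3⟩ | h3 := h3
    swap
    · exact absurd h0 h3.1
    refine (Run.flat hW1 (p := .skip) (Q := (· = τ3)) rfl).mono
      (by simp [Cmd.time]) ?_
    rintro _ _ rfl
    refine Run.block_nil ⟨hL3, ?_, by omega, by simp [e6], fun _ D hD => h3 D hD trivial ?_⟩
    · refine ⟨?_, ?_, ?_, ?_⟩ <;> simp [e5]
    · intro v hv hv'
      have hvt := (mem_interior.1 hv).1
      have hU : ¬ I.Used σ (σ.reg 6) v := by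
        rintro (h | ⟨k, hk, -⟩)
        · exact hD.ne_s_of_mem hv h
        · omega
      obtain h | h | h | h := hv'
      exacts [hU ((h1 v (hD.lt_of_mem hv) hvt).1 h), hvt h, hvt h, hvt h]

/-- With p paths and index r < p, a failed attempt raises p² + r by one, and a successful one leads
to (p + 1)² ≥ p² + r + 1. At the end r = p, so there were at most p² + p attempts. -/
theorem exec_searchLoop (hW : I.n + I.c + I.m + 4 < W) (hb : σ.Bdd W) (hσ : I.SearchInv σ) :
    ∃ k τ, Exec W (.loop (.op .lt (.reg 6) (.reg 5)) swapCmd) σ k τ ∧ I.SearchInv τ ∧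
      τ.reg 6 = τ.reg 5 ∧ k ≤ (I.swapTime + 4) * (2 * (max (τ.reg 5) 1) ^ 2) + 4 := by
  obtain ⟨k, τ, hE, hI, h0, hk⟩ := exec_loop (W := W) (e := .op .lt (.reg 6) (.reg 5))
    (p := swapCmd) (σ := σ) I.SearchInv
    -- The factor n + 2 makes the decrease of n - p outweigh the reset of the index, since p ≤ n.
    (fun σ => (I.n - σ.reg 5) * (I.n + 2) + (σ.reg 5 - σ.reg 6))
    (fun σ => (I.swapTime + 4) * (σ.reg 5 ^ 2 + σ.reg 6)) (by omega) I.swapTime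
    (fun τ => ⟨trivial, trivial⟩) (by
      intro τ hτ hne
      have hlt : τ.reg 6 < τ.reg 5 := by
        by_contra h
        exact hne (by simp [Expr.eval, BinOp.eval, h])
      refine (run_swapCmd hW hτ hlt).mono le_rfl fun υ _ hυ => ⟨hυ.1, ?_⟩
      have hc := hυ.1.family.card_le
      have hcost : (Expr.op BinOp.lt (.reg 6) (.reg 5)).cost = 3 := rfl
      rw [hcost]
      obtain ⟨h5, h6⟩ | ⟨h5, h6⟩ := hυ.2
      · rw [h5] at hc
        simp only [h5, h6]
        constructor
        · obtain ⟨d, hd⟩ := Nat.exists_eq_add_of_le hc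
          rw [show I.n - (τ.reg 5 + 1) = d by omega, show I.n - τ.reg 5 = d + 1 by omega, add_mul]
          omega
        · have : τ.reg 5 ^ 2 + τ.reg 6 + 1 ≤ (τ.reg 5 + 1) ^ 2 + 0 := by nlinarith
          have := Nat.mul_le_mul_left (I.swapTime + 4) this
          rw [mul_add _ _ 1] at this
          omega
      · simp only [h5, h6]
        constructor
        · omega
        · have := mul_add (I.swapTime + 4) (τ.reg 5 ^ 2 + τ.reg 6) 1
          rw [← add_assoc (τ.reg 5 ^ 2)]
          omega) hb hσ
  have h65 : τ.reg 6 = τ.reg 5 := by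
    have hle := hI.le
    have : ¬ τ.reg 6 < τ.reg 5 := fun h => by simp [Expr.eval, BinOp.eval, h] at h0
    omega
  refine ⟨k, τ, hE, hI, h65, ?_⟩
  have h1 : k ≤ (I.swapTime + 4) * (τ.reg 5 ^ 2 + τ.reg 6) + 4 := by
    simp only [Expr.cost] at hk
    omega
  refine h1.trans (Nat.add_le_add_right (Nat.mul_le_mul_left _ ?_) 4)
  have h2 : τ.reg 5 ≤ max (τ.reg 5) 1 := le_max_left _ _
  have h3 : 1 ≤ max (τ.reg 5) 1 := le_max_right _ _
  rw [h65]
  nlinarith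

variable (I) in
/-- The paths with indices from `p` on are the paths of length one in the first `k` list
entries. -/
structure DirectInv (p k : ℕ) (τ : State) : Prop where
  le : p ≤ τ.reg 5
  le_add : τ.reg 5 ≤ p + k
  length : ∀ j < τ.reg 5, p ≤ j → τ.arr 4 j = 1
  first : ∀ j < τ.reg 5, p ≤ j → τ.arr 5 j = I.s
  last : ∀ j < τ.reg 5, p ≤ j → τ.arr 6 j = I.t
  arc : ∀ j < τ.reg 5, p ≤ j → ∃ k' < k, I.ArcAt (τ.arr 3 j) k' I.s I.t
  inj : ∀ j < τ.reg 5, ∀ j' < τ.reg 5, p ≤ j → p ≤ j' → τ.arr 3 j = τ.arr 3 j' → j = j'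
  surj : ∀ i, ∀ k' < k, I.ArcAt i k' I.s I.t → ∃ j < τ.reg 5, p ≤ j ∧ τ.arr 3 j = i

theorem DirectInv.skip {p k : ℕ} (h : I.DirectInv p k σ) (hk : ∀ i, ¬ I.ArcAt i k I.s I.t) :
    I.DirectInv p (k + 1) (σ.setReg 7 (k + 1)) := by
  refine ⟨h.le, h.le_add.trans (by simp), h.length, h.first, h.last, fun j hj hpj => ?_, h.inj,
    fun i k' hk' hi => ?_⟩
  · obtain ⟨k', hk', hi⟩ := h.arc j hj hpj
    exact ⟨k', by omega, hi⟩
  · obtain hk' | rfl := Nat.lt_succ_iff_lt_or_eq.1 hk'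
    exacts [h.surj i k' hk' hi, absurd hi (hk i)]

theorem wp_appendEdgeCmd {p k : ℕ} {τ : State} (h : I.DirectInv p k τ) (hτ : I.Loaded τ)
    (hW : I.n + I.c + I.m + 4 < W) (h7 : τ.reg 7 = k) (hkm : k < I.m) (hp : p ≤ I.n)
    (hk : I.ArcAt (I.col k) k I.s I.t) :
    appendEdgeCmd.wp W τ fun υ => I.DirectInv p (k + 1) (υ.setReg 7 (k + 1)) ∧
      ∀ j < p, υ.slot j = τ.slot j ∧ υ.arr 5 j = τ.arr 5 j ∧ υ.arr 9 j = τ.arr 9 j := by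
  have hle := h.le
  have hle' := h.le_add
  simp only [appendEdgeCmd, Cmd.wp, Cmd.block, Expr.Ok, Expr.eval, BinOp.eval, true_and,
    State.reg_setArr, h7, hτ.s, hτ.t, hτ.col,
    show 1 < W by omega, show τ.reg 5 + 1 < W by omega]
  set q := τ.reg 5 with hq
  have hlt : ∀ {j}, j < q + 1 → j < q ∨ j = q := fun hj => Nat.lt_succ_iff_lt_or_eq.1 hj
  refine ⟨⟨?_, ?_, fun j hj hpj => ?_, fun j hj hpj => ?_, fun j hj hpj => ?_, fun j hj hpj => ?_,
    fun j hj j' hj' hpj hpj' => ?_, fun i k' hk' hi => ?_⟩, fun j hj => ?_⟩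
  · simp
    omega
  · simp
    omega
  · obtain hj | rfl := hlt (by simpa using hj)
    · simpa [hj.ne] using h.length j hj hpj
    · simp
  · obtain hj | rfl := hlt (by simpa using hj)
    · simpa [hj.ne] using h.first j hj hpj
    · simp
  · obtain hj | rfl := hlt (by simpa using hj)
    · simpa [hj.ne] using h.last j hj hpj
    · simp
  · obtain hj | rfl := hlt (by simpa using hj)
    · obtain ⟨k', hk', hi⟩ := h.arc j hj hpj
      exact ⟨k', by omega, by simpa [hj.ne] using hi⟩
    · exact ⟨k, by omega, by simpa using hk⟩
  -- A colour recorded before would come from an earlier list entry joining `s` and `t` in this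
  -- colour, but there is only one such entry.
  · have new : ∀ j < q, p ≤ j → τ.arr 3 j ≠ I.col k := fun j hj hpj he => by
      obtain ⟨k', hk', hi⟩ := h.arc j hj hpj
      rw [he] at hi
      have := hi.unique hk (by omega) hkm
      omega
    obtain hj | rfl := hlt (by simpa using hj) <;> obtain hj' | rfl := hlt (by simpa using hj')
    · simpa [hj.ne, hj'.ne] using h.inj j hj j' hj' hpj hpj'
    · simpa [hj.ne] using fun he => absurd he (new j hj hpj)
    · simpa [hj'.ne] using fun he : I.col k = _ => absurd he.symm (new j' hj' hpj')
    · simp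
  · obtain hk' | rfl := Nat.lt_succ_iff_lt_or_eq.1 hk'
    · obtain ⟨j, hj, hpj, he⟩ := h.surj i k' hk' hi
      have hjq : j ≠ q := hj.ne
      exact ⟨j, by simp; omega, hpj, by simp [hjq, he]⟩
    · refine ⟨q, by simp, hle, ?_⟩
      simpa using hi.1
  · have : j ≠ q := by omega
    simp [State.slot, this]

theorem run_directCmd (hσ : I.Loaded σ) (hW : I.n + I.c + I.m + 4 < W) (hp : σ.reg 5 ≤ I.n) :
    Run W (I.m * 200 + 6) directCmd σ fun τ => I.DirectInv (σ.reg 5) I.m τ ∧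
      ∀ j < σ.reg 5, τ.slot j = σ.slot j ∧ τ.arr 5 j = σ.arr 5 j ∧ τ.arr 9 j = σ.arr 9 j := by
  have hW1 : 1 < W := by omega
  have := Run.forTo (T := directBody.time) (σ := σ) (i := 7) (N := 2) (p := directBody)
    (fun k τ => I.DirectInv (σ.reg 5) k τ ∧
      ∀ j < σ.reg 5, τ.slot j = σ.slot j ∧ τ.arr 5 j = σ.arr 5 j ∧ τ.arr 9 j = σ.arr 9 j) hW1
    (by omega) (by simp [directBody, appendEdgeCmd, Cmd.KeepsReg, Cmd.block])
    (by simp [directBody, appendEdgeCmd, Cmd.KeepsReg, Cmd.block]) ?_ ?_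
  · rw [hσ.m] at this
    refine this.mono ?_ fun τ _ h => h
    simp only [directBody, appendEdgeCmd, Cmd.time, Cmd.block, Expr.cost]
    omega
  · refine ⟨⟨by simp, by simp, ?_, ?_, ?_, ?_, ?_, by simp⟩, fun _ _ => ⟨rfl, rfl, rfl⟩⟩
    all_goals
      intro j hj
      have hj : j < σ.reg 5 := by simpa using hj
      intros
      omega
  · rintro k τ hk hk7 hr ha ⟨hI, hold⟩
    rw [hσ.m] at hk
    have hL : I.Loaded τ := hσ.congr
      (fun r hr5 => hr r (by omega) (by
        simp only [directBody, appendEdgeCmd, Cmd.KeepsReg, Cmd.block]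
        simp
        omega))
      fun a ha3 => ha a (by
        simp only [directBody, appendEdgeCmd, Cmd.KeepsArr, Cmd.block]
        simp
        omega)
    have skip : (∀ i, ¬ I.ArcAt i k I.s I.t) → I.DirectInv (σ.reg 5) (k + 1) (τ.setReg 7 (k + 1)) ∧
        ∀ j < σ.reg 5, τ.slot j = σ.slot j ∧ τ.arr 5 j = σ.arr 5 j ∧ τ.arr 9 j = σ.arr 9 j :=
      fun h => ⟨hI.skip h, hold⟩
    have append : I.ArcAt (I.col k) k I.s I.t → appendEdgeCmd.wp W τ fun υ =>
        I.DirectInv (σ.reg 5) (k + 1) (υ.setReg 7 (k + 1)) ∧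
        ∀ j < σ.reg 5, υ.slot j = σ.slot j ∧ υ.arr 5 j = σ.arr 5 j ∧ υ.arr 9 j = σ.arr 9 j := by
      intro h
      refine Cmd.wp_mono ?_ (wp_appendEdgeCmd hI hL hW hk7 hk hp h)
      rintro υ ⟨h1, h2⟩
      refine ⟨h1, fun j hj => ?_⟩
      rw [(h2 j hj).1, (h2 j hj).2.1, (h2 j hj).2.2]
      exact hold j hj
    have hst := I.s_ne_t
    refine Run.flat hW1 ?_
    simp only [directBody, Cmd.wp, Expr.Ok, Expr.eval, BinOp.eval, true_and, hk7, hL.src, hL.dst,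
      hL.s, hL.t, ne_eq, ite_eq_right_iff, one_ne_zero, imp_false, not_not]
    refine ⟨fun h1 => ⟨fun h2 => append ⟨rfl, .inl ⟨h1, h2⟩⟩, fun h2 => skip ?_⟩,
      fun h1 => ⟨fun h2 => ⟨fun h3 => append ⟨rfl, .inr ⟨h2, h3⟩⟩, fun h3 => skip ?_⟩,
        fun h2 => skip ?_⟩⟩
    all_goals
      rintro i ⟨-, h | h⟩
      all_goals
        obtain ⟨ha, hb⟩ := h
        first
          | contradiction
          | exact hst (by omega)

variable (I) in
/-- The output: the first `p` paths are a locally optimal family, and the others are the paths of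
length one. -/
structure Result (p : ℕ) (τ : State) : Prop where
  direct : I.DirectInv p I.m τ
  valid : ∀ k < p, I.Valid (τ.slot k)
  first : ∀ k < p, τ.arr 5 k = I.s
  last : ∀ k < p, τ.arr 9 k = I.t
  disjoint : ∀ k < p, ∀ k' < p, k ≠ k' → Disjoint (I.interior (τ.slot k)) (I.interior (τ.slot k'))
  opt : ∀ r < p, ∀ A B, I.Valid A → I.Valid B → Disjoint (I.interior A) (I.interior B) →
    (∀ k < p, k ≠ r → Disjoint (I.interior A) (I.interior (τ.slot k))) →
    ¬ ∀ k < p, k ≠ r → Disjoint (I.interior B) (I.interior (τ.slot k))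
  nonempty : p = 0 → ∀ D, ¬ I.Valid D

/-- The local search is charged to the number of long paths, which the number of all output paths
dominates; the two single passes cost O(c(n+m)). -/
theorem exec_mainCmd (hW : I.n + I.c + I.m + 4 < W) (hb : σ.Bdd W) (hσ : I.Loaded σ)
    (h5 : σ.reg 5 = 0) (h6 : σ.reg 6 = 0) :
    ∃ k τ p, Exec W mainCmd σ k τ ∧ I.Result p τ ∧
      k ≤ 1000000 * (max (τ.reg 5) 1 ^ 2 * (I.c * (I.n + I.m))) := by
  obtain ⟨k1, τ1, hE1, hk1, hI1⟩ := run_startCmd hσ hW h5 h6 hb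
  have hb1 := hE1.bdd hb
  obtain ⟨k2, τ2, hE2, hI2, h62, hk2⟩ := exec_searchLoop hW hb1 hI1
  have hb2 := hE2.bdd hb1
  obtain ⟨k3, τ3, hE3, hk3, hI3, hold⟩ := run_directCmd hI2.loaded hW hI2.family.card_le hb2
  refine ⟨_, τ3, τ2.reg 5, .seq hE1 (.seq hE2 (.seq hE3 (.skip τ3))), ?_, ?_⟩
  · refine ⟨hI3, fun k hk => ?_, fun k hk => ?_, fun k hk => ?_, fun k hk k' hk' hne => ?_,
      fun r hr A B hA hB hAB hAk hBk => ?_, hI2.nonempty⟩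
    · rw [(hold k hk).1]
      exact hI2.family.valid k hk
    · rw [(hold k hk).2.1]
      exact hI2.family.first k hk
    · rw [(hold k hk).2.2]
      exact hI2.family.last k hk
    · rw [(hold k hk).1, (hold k' hk').1]
      exact hI2.family.disjoint k hk k' hk' hne
    · have key : ∀ D, I.Valid D → (∀ k < τ2.reg 5, k ≠ r →
          Disjoint (I.interior D) (I.interior (τ3.slot k))) → I.Avoids (I.Used τ2 r) D := by
        rintro D hD h v hv (hs | ⟨k, hk, hkr, hvk⟩)
        · exact hD.ne_s_of_mem hv hs
        · rw [← (hold k hk).1] at hvk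
          exact Finset.disjoint_left.1 (h k hk hkr) hv hvk
      exact hI2.opt r (by omega) A B ⟨hA, hB, key A hA hAk, key B hB hBk, hAB⟩
  · have hM : max (τ2.reg 5) 1 ^ 2 ≤ max (τ3.reg 5) 1 ^ 2 :=
      Nat.pow_le_pow_left (max_le_max_right _ hI3.le) _
    have h1M : 1 ≤ max (τ3.reg 5) 1 ^ 2 := Nat.one_le_pow _ _ (by simp)
    set M := max (τ3.reg 5) 1 ^ 2
    have hU1 : I.n + I.m ≤ I.c * (I.n + I.m) := Nat.le_mul_of_pos_left _ I.c_pos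
    have htl := I.t_lt
    have hUM : I.c * (I.n + I.m) ≤ M * (I.c * (I.n + I.m)) := Nat.le_mul_of_pos_left _ h1M
    have hST : I.searchTime = I.c * (I.n + I.m) * 1000 := rfl
    -- Eighty searches at 1000 steps per unit account for 80000; the rest absorbs the lower-order
    -- terms.
    have hBT : I.swapTime + 4 ≤ 100000 * (I.c * (I.n + I.m)) := by
      simp only [swapTime, branchTime]
      omega
    have hk2' : k2 ≤ 200000 * (M * (I.c * (I.n + I.m))) + 4 := by
      refine hk2.trans (Nat.add_le_add_right ?_ 4)
      calc (I.swapTime + 4) * (2 * max (τ2.reg 5) 1 ^ 2)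
          ≤ 100000 * (I.c * (I.n + I.m)) * (2 * M) := by gcongr
        _ = _ := by ring
    omega

end ArcInstance

/-! ### Colour graphs -/

namespace ColorGraph

open ArcInstance

variable {n c m : ℕ} {G : Fin c → SimpleGraph (Fin n)} {s t : Fin n}

theorem EdgeListing.inputState_arr (L : EdgeListing G m) (s t : Fin n) {k : ℕ} (hk : k < m) :
    (L.inputState s t).arr 0 k = L.src ⟨k, hk⟩ ∧ (L.inputState s t).arr 1 k = L.dst ⟨k, hk⟩ ∧
      (L.inputState s t).arr 2 k = L.color ⟨k, hk⟩ := by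
  simp [EdgeListing.inputState, hk]

/-- The instance that is given by a list of the coloured edges. -/
def EdgeListing.toArcInstance (L : EdgeListing G m) (hst : s ≠ t) (hc : 1 ≤ c) : ArcInstance where
  n := n
  c := c
  m := m
  s := s
  t := t
  src := (L.inputState s t).arr 0
  dst := (L.inputState s t).arr 1
  col := (L.inputState s t).arr 2
  src_lt k hk := (L.inputState_arr s t hk).1 ▸ Fin.is_lt _
  dst_lt k hk := (L.inputState_arr s t hk).2.1 ▸ Fin.is_lt _
  col_lt k hk := (L.inputState_arr s t hk).2.2 ▸ Fin.is_lt _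
  ne k hk := by
    rw [(L.inputState_arr s t hk).1, (L.inputState_arr s t hk).2.1]
    exact fun h => (L.adj ⟨k, hk⟩).ne (Fin.ext h)
  inj k hk k' hk' h1 h2 := by
    rw [(L.inputState_arr s t hk).2.2, (L.inputState_arr s t hk').2.2] at h1
    rw [(L.inputState_arr s t hk).1, (L.inputState_arr s t hk').1, (L.inputState_arr s t hk).2.1,
      (L.inputState_arr s t hk').2.1] at h2
    obtain ⟨l, -, hl⟩ := L.existsUnique _ _ _ (L.adj ⟨k', hk'⟩)
    have e1 := hl ⟨k, hk⟩ ⟨Fin.ext h1, by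
      simpa only [Sym2.eq_iff, Fin.ext_iff] using h2⟩
    have e2 := hl ⟨k', hk'⟩ ⟨rfl, rfl⟩
    simpa using e1.trans e2.symm
  s_lt := s.is_lt
  t_lt := t.is_lt
  s_ne_t h := hst (Fin.ext h)
  c_pos := hc

variable {L : EdgeListing G m} {hst : s ≠ t} {hc : 1 ≤ c}

theorem adj_toArcInstance {i a b : ℕ} : (L.toArcInstance hst hc).Adj i a b ↔
    ∃ (hi : i < c) (ha : a < n) (hb : b < n), (G ⟨i, hi⟩).Adj ⟨a, ha⟩ ⟨b, hb⟩ := by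
  constructor
  · rintro ⟨k, hk, h1, h2⟩
    have hk : k < m := hk
    obtain ⟨e0, e1, e2⟩ := L.inputState_arr s t hk
    have h1 : (L.inputState s t).arr 2 k = i := h1
    have h2 : ((L.inputState s t).arr 0 k = a ∧ (L.inputState s t).arr 1 k = b) ∨
      ((L.inputState s t).arr 1 k = a ∧ (L.inputState s t).arr 0 k = b) := h2
    rw [e2] at h1
    rw [e0, e1] at h2
    subst h1
    obtain ⟨rfl, rfl⟩ | ⟨rfl, rfl⟩ := h2
    · exact ⟨Fin.is_lt _, Fin.is_lt _, Fin.is_lt _, L.adj ⟨k, hk⟩⟩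
    · exact ⟨Fin.is_lt _, Fin.is_lt _, Fin.is_lt _, (L.adj ⟨k, hk⟩).symm⟩
  · rintro ⟨hi, ha, hb, h⟩
    obtain ⟨⟨k, hk⟩, ⟨h1, h2⟩, -⟩ := L.existsUnique _ _ _ h
    obtain ⟨e0, e1, e2⟩ := L.inputState_arr s t hk
    refine ⟨k, hk, ?_, ?_⟩
    · exact e2.trans (by rw [h1])
    · change ((L.inputState s t).arr 0 k = a ∧ (L.inputState s t).arr 1 k = b) ∨
        ((L.inputState s t).arr 1 k = a ∧ (L.inputState s t).arr 0 k = b)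
      rw [e0, e1]
      simpa [Sym2.eq_iff, Fin.ext_iff, and_comm] using h2

/-- The `j`-th node of the path with data `D`. -/
def node (s t : ℕ) (D : PathData) : ℕ → ℕ
  | 0 => s
  | 1 => D.x
  | 2 => D.y
  | 3 => D.z
  | _ => t

/-- For lengths two and three the padding by `t` doubles as the last node, so `node` is right up to
the length of the path. -/
theorem exists_uniColorPath_of_valid {D : PathData} (hD : (L.toArcInstance hst hc).Valid D) :
    ∃ P : UniColorPath G s t, (P.color : ℕ) = D.col ∧ P.walk.length = D.len ∧
      (∀ j ≤ D.len, (P.walk.getVert j : ℕ) = node s t D j) ∧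
      ∀ v : Fin n, v ∈ P.interior ↔ (v : ℕ) ∈ (L.toArcInstance hst hc).interior D := by
  have hs : (L.toArcInstance hst hc).s = s := rfl
  have ht : (L.toArcInstance hst hc).t = t := rfl
  have e0 : (s : ℕ) ≠ t := fun h => hst (Fin.ext h)
  obtain ⟨len, col, x, y, z⟩ := D
  obtain ⟨h0, h1, h2, h3, h4⟩ | ⟨h0, h1, h2, h3, h4, h5, h6⟩ |
    ⟨h0, h1, h2, h3, h4, h5, h6, h7, h8, h9⟩ := hD
  · simp only [adj_toArcInstance] at h0 h1 h2 h3 h4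
    obtain ⟨hi, _, hx, h1⟩ := h1
    obtain ⟨_, _, _, h2⟩ := h2
    rw [ht] at h3 h4
    subst h0 h3 h4
    have h1 : (G ⟨col, hi⟩).Adj s ⟨x, hx⟩ := h1
    have h2 : (G ⟨col, hi⟩).Adj ⟨x, hx⟩ t := h2
    have e1 := h1.ne
    have e2 := h2.ne
    simp only [ne_eq, Fin.ext_iff] at e1 e2
    have hp : (.cons h1 (.cons h2 .nil) : (G ⟨col, hi⟩).Walk s t).IsPath := by
      simp [SimpleGraph.Walk.isPath_def, Fin.ext_iff]
      omega
    refine ⟨⟨⟨col, hi⟩, _, hp⟩, rfl, by simp, ?_, ?_⟩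
    · intro j hj
      have hj : j ≤ 2 := hj
      interval_cases j <;> simp [node]
    · intro v
      simp [UniColorPath.interior, ArcInstance.mem_interior, Fin.ext_iff, ht]
      omega
  · simp only [adj_toArcInstance] at h0 h1 h2 h3 h4 h5 h6
    obtain ⟨hi, _, hx, h1⟩ := h1
    obtain ⟨_, _, hy, h2⟩ := h2
    obtain ⟨_, _, _, h3⟩ := h3
    rw [ht] at h4 h5
    rw [hs] at h6
    subst h0 h4
    have h1 : (G ⟨col, hi⟩).Adj s ⟨x, hx⟩ := h1
    have h3 : (G ⟨col, hi⟩).Adj ⟨y, hy⟩ t := h3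
    have e1 := h1.ne
    have e2 := h2.ne
    have e3 := h3.ne
    simp only [ne_eq, Fin.ext_iff] at e1 e2 e3
    have hp : (.cons h1 (.cons h2 (.cons h3 .nil)) : (G ⟨col, hi⟩).Walk s t).IsPath := by
      simp [SimpleGraph.Walk.isPath_def, Fin.ext_iff]
      omega
    refine ⟨⟨⟨col, hi⟩, _, hp⟩, rfl, by simp, ?_, ?_⟩
    · intro j hj
      have hj : j ≤ 3 := hj
      interval_cases j <;> simp [node]
    · intro v
      simp [UniColorPath.interior, ArcInstance.mem_interior, Fin.ext_iff, ht]
      omega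
  · simp only [adj_toArcInstance] at h0 h1 h2 h3 h4 h5 h6 h7 h8 h9
    obtain ⟨hi, _, hx, h1⟩ := h1
    obtain ⟨_, _, hy, h2⟩ := h2
    obtain ⟨_, _, hz, h3⟩ := h3
    obtain ⟨_, _, _, h4⟩ := h4
    rw [ht] at h5 h7
    rw [hs] at h6 h8
    subst h0
    have h1 : (G ⟨col, hi⟩).Adj s ⟨x, hx⟩ := h1
    have h4 : (G ⟨col, hi⟩).Adj ⟨z, hz⟩ t := h4
    have e1 := h1.ne
    have e2 := h2.ne
    have e3 := h3.ne
    have e4 := h4.ne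
    simp only [ne_eq, Fin.ext_iff] at e1 e2 e3 e4
    have hp : (.cons h1 (.cons h2 (.cons h3 (.cons h4 .nil))) : (G ⟨col, hi⟩).Walk s t).IsPath := by
      simp [SimpleGraph.Walk.isPath_def, Fin.ext_iff]
      omega
    refine ⟨⟨⟨col, hi⟩, _, hp⟩, rfl, by simp, ?_, ?_⟩
    · intro j hj
      have hj : j ≤ 4 := hj
      interval_cases j <;> simp [node]
    · intro v
      simp [UniColorPath.interior, ArcInstance.mem_interior, Fin.ext_iff, ht]
      omega

theorem exists_valid_of_uniColorPath (P : UniColorPath G s t) (hP : P.walk.length ≤ 4)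
    (h1 : P.walk.length ≠ 1) : ∃ D, (L.toArcInstance hst hc).Valid D ∧
      ∀ v : Fin n, v ∈ P.interior ↔ (v : ℕ) ∈ (L.toArcInstance hst hc).interior D := by
  have hs : (L.toArcInstance hst hc).s = s := rfl
  have ht : (L.toArcInstance hst hc).t = t := rfl
  obtain ⟨i, w, hw⟩ := P
  have adj : ∀ {a b : Fin n}, (G i).Adj a b → (L.toArcInstance hst hc).Adj i a b := fun h =>
    adj_toArcInstance.2 ⟨i.is_lt, Fin.is_lt _, Fin.is_lt _, h⟩
  cases w with
  | nil => exact absurd rfl hst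
  | @cons _ x _ a1 w =>
  cases w with
  | nil => exact absurd rfl h1
  | @cons _ y _ a2 w =>
  cases w with
  | nil =>
    refine ⟨⟨2, i, x, t, t⟩, .inl ⟨rfl, adj a1, adj a2, rfl, rfl⟩, fun v => ?_⟩
    have := a1.ne
    have := a2.ne
    simp [UniColorPath.interior, ArcInstance.mem_interior, Fin.ext_iff, hs, ht] at *
    omega
  | @cons _ z _ a3 w =>
  simp [SimpleGraph.Walk.isPath_def, Fin.ext_iff] at hw
  cases w with
  | nil =>
    simp at hw
    refine ⟨⟨3, i, x, y, t⟩, .inr (.inl ⟨rfl, adj a1, adj a2, adj a3, rfl, ?_, ?_⟩), fun v => ?_⟩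
    · change (x : ℕ) ≠ t
      omega
    · change (y : ℕ) ≠ s
      omega
    · simp [UniColorPath.interior, ArcInstance.mem_interior, Fin.ext_iff, hs, ht] at *
      omega
  | @cons _ u _ a4 w =>
  cases w with
  | nil =>
    simp [Fin.ext_iff] at hw
    refine ⟨⟨4, i, x, y, z⟩, .inr (.inr ⟨rfl, adj a1, adj a2, adj a3, adj a4, ?_, ?_, ?_, ?_, ?_⟩),
      fun v => ?_⟩
    · change (x : ℕ) ≠ t
      omega
    · change (y : ℕ) ≠ s
      omega
    · change (y : ℕ) ≠ t
      omega
    · change (z : ℕ) ≠ s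
      omega
    · change (x : ℕ) ≠ z
      omega
    · simp [UniColorPath.interior, ArcInstance.mem_interior, Fin.ext_iff, hs, ht] at *
      omega
  | cons _ w =>
    simp at hP
    omega

/-! ### Feasibility and approximation ratio of the output -/

theorem UniColorPath.adj_of_length_eq_one (P : UniColorPath G s t) (h : P.walk.length = 1) :
    (G P.color).Adj s t := P.walk.adj_of_length_eq_one h

theorem UniColorPath.eq_of_length_eq_one {P P' : UniColorPath G s t} (h : P.walk.length = 1)
    (h' : P'.walk.length = 1) (hc : P.color = P'.color) : P = P' := by
  obtain ⟨i, w, hw⟩ := P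
  obtain ⟨i', w', hw'⟩ := P'
  obtain rfl : i = i' := hc
  cases w with
  | nil => simp at h
  | cons a w =>
  cases w with
  | cons _ w => simp at h
  | nil =>
  cases w' with
  | nil => simp at h'
  | cons a w' =>
  cases w' with
  | cons _ w' => simp at h'
  | nil => rfl

theorem exists_uniColorPath_of_adj {i : ℕ} (h : (L.toArcInstance hst hc).Adj i s t) :
    ∃ P : UniColorPath G s t, (P.color : ℕ) = i ∧ P.walk.length = 1 ∧ ∀ v, v ∉ P.interior := by
  obtain ⟨hi, _, _, h⟩ := adj_toArcInstance.1 h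
  refine ⟨⟨⟨i, hi⟩, .cons h .nil, ?_⟩, rfl, ?_, fun v => ?_⟩
  · simp [SimpleGraph.Walk.isPath_def, hst]
  · simp
  · simp [UniColorPath.interior]
    tauto

/-- The single-edge paths of any solution have different colours, all of which are in the output, so
no factor is lost on them; the factor two arises only for the longer paths. -/
theorem card_le_of_result {p : ℕ} {τ : State} (h : (L.toArcInstance hst hc).Result p τ) {q : ℕ}
    {Q : Fin q → UniColorPath G s t} (hQ : IsDisjointFamily 4 Q) : q ≤ 2 * τ.reg 5 := by
  classical
  set I := L.toArcInstance hst hc with hI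
  have hdir : Fintype.card {k // (Q k).walk.length = 1} ≤ τ.reg 5 - p := by
    have : ∀ k : {k // (Q k).walk.length = 1}, ∃ j < τ.reg 5, p ≤ j ∧ τ.arr 3 j = (Q k).color := by
      rintro ⟨k, hk⟩
      obtain ⟨l, hl, hl'⟩ : I.Adj (Q k).color s t :=
        adj_toArcInstance.2 ⟨Fin.is_lt _, Fin.is_lt _, Fin.is_lt _, (Q k).adj_of_length_eq_one hk⟩
      exact h.direct.surj _ l hl hl'
    choose f hf1 hf2 hf3 using this
    rw [← Finset.card_univ, ← Nat.card_Ico]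
    refine Finset.card_le_card_of_injOn f (fun k _ => by simpa using ⟨hf2 k, hf1 k⟩) ?_
    intro k _ k' _ hkk
    have h1 : ((Q k).color : ℕ) = (Q k').color := by rw [← hf3, ← hf3, hkk]
    exact Subtype.ext (hQ.injective
      (UniColorPath.eq_of_length_eq_one k.2 k'.2 (Fin.ext h1)))
  have hlong : Fintype.card {k // ¬ (Q k).walk.length = 1} ≤ 2 * p := by
    have : ∀ k : {k // ¬ (Q k).walk.length = 1}, ∃ D, I.Valid D ∧
        ∀ v : Fin n, v ∈ (Q k).interior ↔ (v : ℕ) ∈ I.interior D := fun k =>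
      exists_valid_of_uniColorPath _ (hQ.length_le k) k.2
    choose D hD hDv using this
    -- The packing bound needs a nonempty family; an empty one means that there is no longer path at
    -- all.
    obtain rfl | hp := Nat.eq_zero_or_pos p
    · rw [Nat.mul_zero, Nat.le_zero, Fintype.card_eq_zero_iff]
      exact ⟨fun k => h.nonempty rfl _ (hD k)⟩
    · have : Nonempty (Fin p) := ⟨⟨0, hp⟩⟩
      refine (card_le_two_mul_card_of_locally_optimal
        (𝒜 := {A | ∃ D, I.Valid D ∧ A = I.interior D}) ?_
        (F := fun k : Fin p => I.interior (τ.slot k)) (Q := fun k => I.interior (D k))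
        (fun k => ⟨_, h.valid k k.2, rfl⟩) (fun k => ⟨_, hD k, rfl⟩) ?_ ?_ ?_).trans
        (by rw [Fintype.card_fin])
      · rintro _ ⟨D, -, rfl⟩
        exact card_interior_le
      · exact fun k k' hne => h.disjoint k k.2 k' k'.2 fun he => hne (Fin.ext he)
      · intro k k' hne
        have hd := hQ.disjoint (fun he => hne (Subtype.ext he) : (k : Fin q) ≠ k')
        refine Finset.disjoint_left.2 fun v hv hv' => ?_
        have hvn : v < n := (hD k).lt_of_mem hv
        exact Set.disjoint_left.1 hd ((hDv k ⟨v, hvn⟩).2 hv) ((hDv k' ⟨v, hvn⟩).2 hv')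
      · rintro r _ ⟨A, hA, rfl⟩ _ ⟨B, hB, rfl⟩ hAB hAk hBk
        exact h.opt r r.2 A B hA hB hAB
          (fun k hk hkr => hAk ⟨k, hk⟩ fun he => hkr (Fin.ext_iff.1 he))
          (fun k hk hkr => hBk ⟨k, hk⟩ fun he => hkr (Fin.ext_iff.1 he))
  have hsplit := Fintype.card_subtype_compl fun k => (Q k).walk.length = 1
  have hle := Fintype.card_subtype_le fun k => (Q k).walk.length = 1
  rw [Fintype.card_fin] at hsplit hle
  have := h.direct.le
  omega

/-- Only the first `p` paths have internal nodes, so disjointness is that of the stored family. It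
also makes the long paths distinct, since each has an internal node; the paths of length one differ
by their colours. -/
theorem exists_family_of_result {p : ℕ} {τ : State} (h : (L.toArcInstance hst hc).Result p τ) :
    ∃ P : Fin (τ.reg 5) → UniColorPath G s t, IsOutput τ P ∧ IsDisjointFamily 4 P := by
  set I := L.toArcInstance hst hc with hI
  have hs : I.s = s := rfl
  have ht : I.t = t := rfl
  have : ∀ k : Fin (τ.reg 5), ∃ P : UniColorPath G s t, τ.arr 3 k = P.color ∧
      τ.arr 4 k = P.walk.length ∧ P.walk.length ≤ 4 ∧
      (∀ j ≤ P.walk.length, τ.arr (5 + j) k = P.walk.getVert j) ∧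
      ∀ v : Fin n, v ∈ P.interior ↔ (k : ℕ) < p ∧ (v : ℕ) ∈ I.interior (τ.slot k) := by
    intro k
    by_cases hk : (k : ℕ) < p
    · have hv := h.valid k hk
      obtain ⟨P, h1, h2, h3, h4⟩ := exists_uniColorPath_of_valid hv
      refine ⟨P, h1.symm, h2.symm, h2.trans_le hv.len_mem.2, fun j hj => ?_, fun v => ?_⟩
      · rw [h2] at hj
        rw [h3 j hj]
        have := hj.trans hv.len_mem.2
        interval_cases j
        exacts [h.first k hk, rfl, rfl, rfl, h.last k hk]
      · rw [h4]
        simp [hk, hI]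
    · have hpk : p ≤ k := by omega
      obtain ⟨l, hl, hl'⟩ := h.direct.arc k k.2 hpk
      obtain ⟨P, h1, h2, h3⟩ := exists_uniColorPath_of_adj (L := L) (hst := hst) (hc := hc)
        ⟨l, (show l < m from hl), hl'⟩
      refine ⟨P, h1.symm, (h.direct.length k k.2 hpk).trans h2.symm, by omega, fun j hj => ?_,
        fun v => by simp [h3, hk]⟩
      rw [h2] at hj
      interval_cases j
      · rw [SimpleGraph.Walk.getVert_zero]
        exact h.direct.first k k.2 hpk
      · rw [← h2, SimpleGraph.Walk.getVert_length, h2]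
        exact h.direct.last k k.2 hpk
  choose P hcol hlen hle hnode hint using this
  have hdisj : ∀ k k' : Fin (τ.reg 5), k ≠ k' → ∀ v : Fin n, v ∈ (P k).interior →
      v ∉ (P k').interior := by
    intro k k' hne v hv hv'
    obtain ⟨h1, h2⟩ := (hint k v).1 hv
    obtain ⟨h3, h4⟩ := (hint k' v).1 hv'
    exact Finset.disjoint_left.1 (h.disjoint k h1 k' h3 fun he => hne (Fin.ext he)) h2 h4
  refine ⟨P, ⟨rfl, hcol, hlen, hnode⟩, ⟨fun k k' hkk => ?_, hle, fun k k' hne =>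
    Set.disjoint_left.2 (hdisj k k' hne)⟩⟩
  by_contra hne
  have key : ∀ k k' : Fin (τ.reg 5), k ≠ k' → P k = P k' → ¬ (k : ℕ) < p := by
    intro k k' hne hkk hk
    have hx := (h.valid k hk).x_mem_interior
    have hxn : (τ.slot k).x < n := (h.valid k hk).lt_of_mem hx
    have hx' := (hint k ⟨_, hxn⟩).2 ⟨hk, hx⟩
    exact hdisj k k' hne _ hx' (hkk ▸ hx')
  have h1 := key k k' hne hkk
  have h2 := key k' k (Ne.symm hne) hkk.symm
  exact hne (Fin.ext (h.direct.inj k k.2 k' k'.2 (by omega) (by omega) (by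
    rw [hcol, hcol, hkk])))

end ColorGraph

open ColorGraph in
theorem mainTheorem5 :
    ∃ (prog : RAM.Cmd) (K b : ℕ),
      ∀ (n c m : ℕ) (G : Fin c → SimpleGraph (Fin n)) (L : ColorGraph.EdgeListing G m)
        (s t : Fin n), 1 ≤ c → s ≠ t →
        ∃ (time : ℕ) (σ : RAM.State) (p : ℕ) (P : Fin p → ColorGraph.UniColorPath G s t),
          RAM.Exec ((n + c + m) ^ b) prog (L.inputState s t) time σ ∧
          ColorGraph.IsOutput σ P ∧
          ColorGraph.IsDisjointFamily 4 P ∧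
          (∀ (q : ℕ) (Q : Fin q → ColorGraph.UniColorPath G s t),
            ColorGraph.IsDisjointFamily 4 Q → q ≤ 2 * p) ∧
          time ≤ K * ((max p 1) ^ 2 * (c ^ 2 * n + c * ColorGraph.numEdges G)) := by
  refine ⟨RAM.mainCmd, 1000000, 2, fun n c m G L s t hc hst => ?_⟩
  have hn : 2 ≤ n := by
    have h1 := s.is_lt
    have h2 := t.is_lt
    have h3 : (s : ℕ) ≠ t := fun h => hst (Fin.ext h)
    omega
  -- The exponent 2 suffices for the word bound because n ≥ 2 and c ≥ 1 give n + c + m ≥ 3.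
  have hW : n + c + m + 4 < (n + c + m) ^ 2 := by nlinarith
  have hb : (L.inputState s t).Bdd ((n + c + m) ^ 2) := by
    refine ⟨fun r => ?_, fun a x => ?_⟩
    · have h1 := s.is_lt
      have h2 := t.is_lt
      simp only [EdgeListing.inputState]
      split <;> omega
    · simp only [EdgeListing.inputState]
      split_ifs with hx
      · have h1 := (L.src ⟨x, hx⟩).is_lt
        have h2 := (L.dst ⟨x, hx⟩).is_lt
        have h3 := (L.color ⟨x, hx⟩).is_lt
        split <;> omega
      · omega
  obtain ⟨k, τ, p, hE, hR, hk⟩ := (L.toArcInstance hst hc).exec_mainCmd (W := (n + c + m) ^ 2)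
    hW hb ⟨rfl, rfl, rfl, rfl, rfl, rfl, rfl, rfl⟩ rfl rfl
  obtain ⟨P, hP1, hP2⟩ := exists_family_of_result hR
  refine ⟨k, τ, τ.reg 5, P, hE, hP1, hP2, fun q Q hQ => card_le_of_result hR hQ, hk.trans ?_⟩
  rw [L.numEdges_eq]
  refine Nat.mul_le_mul_left _ (Nat.mul_le_mul_left _ ?_)
  change c * (n + m) ≤ _
  -- The program even satisfies the bound with c(n + m) in place of c²n + cm.
  have : c * n ≤ c ^ 2 * n := Nat.mul_le_mul_right _ (Nat.le_self_pow (by omega) c)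
  rw [mul_add]
  omega
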